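/- **Definitions.** A metric on a group $G$ is bi-invariant if it is invariant under all left and right translations. A *metric family of groups* $\mathcal{G}=\{(G_i,d_i):i\in I\}$ consists of nontrivial groups $G_i$ with bi-invariant metrics $d_i$ of uniformly bounded diameter. A group $\Gamma$ is *$\mathcal{G}$-approximable* if there is $c>0$ such that for every finite $F\subseteq\Gamma$ and every $\epsilon>0$ there are $i\in I$ and a function $\varphi:\Gamma\to G_i$ which is unital ($\varphi(e)=e$), $(F,\epsilon)$-multiplicative ($d_i(\varphi(gh),\varphi(g)\varphi(h))<\epsilon$ for all $g,h\in F$ with $gh\in F$), and $(F,c)$-separating ($d_i(\varphi(g),e)>c$ for all $e\neq g\in F$). A group is * *sofic* if it is approximable by the family of nontrivial groups $\mathrm{Sym}(n)$, $n\in\mathbb{N}$, with the normalized Hamming metrics $d_n(\sigma,\tau)=\frac1n|\{a:\sigma(a)\neq\tau(a)\}|$; * *$\mathbb{K}$-linear sofic*, for a field $\mathbb{K}$, if it is approximable by the family of nontrivial groups $\mathrm{GL}_n(\mathbb{K})$, $n\in\mathbb{N}$, with the metrics $d(M,N)=\frac1n\operatorname{rk}(M-N)$; * *hyperlinear* if it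 is approximable by the family of nontrivial unitary groups $U(n)$, $n\in\mathbb{N}$, with the metrics $d(A,B)=\sqrt{\frac1n\sum_{i,j}|A_{ij}-B_{ij}|^2}$; * *weakly sofic* if it is approximable by the family of all finite groups equipped with bi-invariant metrics of diameter one. For groups $\Delta,\Lambda$ and a finite set $E\subseteq\Delta$, a function $\pi:E\to\Lambda$ is a *partial homomorphism* if $\pi(gh)=\pi(g)\pi(h)$ whenever $g,h,gh\in E$. Let $\mathcal{C}$ be a class of groups. A homomorphism $\beta:\Gamma\to\mathrm{Aut}(\Delta)$ is a *sofic $\mathcal{C}$-action* if for all finite $F\subseteq\Gamma$, $E\subseteq\Delta$ and all $\epsilon>0$ there are a group $\Lambda\in\mathcal{C}$, a finite set $A$, a unital function $\varphi:\Gamma\to\mathrm{Sym}(A)$ which is $(F,\epsilon)$-multiplicative for the normalized Hamming metric on $\mathrm{Sym}(A)$, a subset $S\subseteq A$ with $|S|>(1-\epsilon)|A|$, and injective partial homomorphisms $\pi_s:E\hookrightarrow\Lambda$ ($s\in S$), such that for all $g\in F$, $h\in E$, $s\in S$ with $\varphi(g)\cdot s\in S$ and $\beta(g)^{-1}[h]\in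 E$ we have $$\pi_{\varphi(g)\cdot s}(h)=\pi_s(\beta(g)^{-1}[h]).$$ **Statement.** Let $\mathcal{C}$ be one of the following classes of groups: (a) the sofic groups; (b) the $\mathbb{K}$-linear sofic groups, for any field $\mathbb{K}$; (c) the hyperlinear groups; (d) the weakly sofic groups. Let $\Gamma,\Delta\in\mathcal{C}$ and let $\beta:\Gamma\to\mathrm{Aut}(\Delta)$ be a sofic $\mathcal{C}$-action. Then $\Delta\rtimes_\beta\Gamma\in\mathcal{C}$. -/

import Mathlib

/-! Metric approximations of groups and sofic actions by automorphisms. -/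

universe u v w x

namespace MetricApprox

/-- `d` is a bi-invariant metric on the group `G`. -/
structure IsBiinvariantMetric {G : Type v} [Group G] (d : G → G → ℝ) : Prop where
  self : ∀ g, d g g = 0
  eq_of_dist_eq_zero : ∀ {g h}, d g h = 0 → g = h
  symm : ∀ g h, d g h = d h g
  triangle : ∀ g h k, d g k ≤ d g h + d h k
  mul_left : ∀ a g h, d (a * g) (a * h) = d g h
  mul_right : ∀ a g h, d (g * a) (h * a) = d g h

/-- A metric family of groups: nontrivial groups with bi-invariant metrics of uniformly bounded
diameter. -/
structure MetricFamily where
  /-- the index set -/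
  Idx : Type u
  /-- the groups of the family -/
  G : Idx → Type v
  [group : ∀ i, Group (G i)]
  [nontrivial : ∀ i, Nontrivial (G i)]
  /-- the metrics of the family -/
  dist : ∀ i, G i → G i → ℝ
  isBiinvariantMetric : ∀ i, IsBiinvariantMetric (dist i)
  bounded : ∃ D : ℝ, ∀ i g h, dist i g h ≤ D

attribute [instance] MetricFamily.group MetricFamily.nontrivial

section Representations

variable {Γ : Type w} [Group Γ] {G : Type v} [Group G]

/-- `φ` is `(F, ε)`-multiplicative with respect to `d`. -/
def IsMultiplicativeOn (d : G → G → ℝ) (F : Finset Γ) (ε : ℝ) (φ : Γ → G) : Prop :=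
  ∀ g ∈ F, ∀ h ∈ F, g * h ∈ F → d (φ (g * h)) (φ g * φ h) < ε

/-- `φ` is `(F, c)`-separating with respect to `d`. -/
def IsSeparatingOn (d : G → G → ℝ) (F : Finset Γ) (c : ℝ) (φ : Γ → G) : Prop :=
  ∀ g ∈ F, g ≠ 1 → c < d (φ g) 1

/-- `φ` is unital. -/
def IsUnital (φ : Γ → G) : Prop := φ 1 = 1

end Representations

/-- `Γ` is `(𝒢, c)`-approximable: for all finite `F` and all `ε > 0` there is an
`(F, ε, c)`-`𝒢`-representation of `Γ`. -/
def MetricFamily.IsApproximableWith (𝒢 : MetricFamily.{u, v}) (c : ℝ)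
    (Γ : Type w) [Group Γ] : Prop :=
  ∀ (F : Finset Γ) (ε : ℝ), 0 < ε → ∃ (i : 𝒢.Idx) (φ : Γ → 𝒢.G i),
    IsMultiplicativeOn (𝒢.dist i) F ε φ ∧ IsSeparatingOn (𝒢.dist i) F c φ ∧ IsUnital φ

/-- `Γ` is `𝒢`-approximable. -/
def MetricFamily.IsApproximable (𝒢 : MetricFamily.{u, v}) (Γ : Type w) [Group Γ] : Prop :=
  ∃ c : ℝ, 0 < c ∧ 𝒢.IsApproximableWith c Γ

section Sofic

/-- The normalized Hamming metric on `Sym(A)`: the proportion of points of `A` at which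
`σ` and `τ` differ. -/
noncomputable def hammingMetric {A : Type v} [Fintype A] [DecidableEq A]
    (σ τ : Equiv.Perm A) : ℝ :=
  (hammingDist (σ : A → A) (τ : A → A) : ℝ) / Fintype.card A

theorem isBiinvariantMetric_hammingMetric {A : Type v} [Fintype A] [DecidableEq A] [Nonempty A] :
    IsBiinvariantMetric (hammingMetric (A := A)) where
  self g := by simp [hammingMetric]
  eq_of_dist_eq_zero {g h} H := by
    have : hammingDist (g : A → A) (h : A → A) = 0 := by
      simpa [hammingMetric] using H
    exact DFunLike.coe_injective (hammingDist_eq_zero.1 this)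
  symm g h := by simp only [hammingMetric, hammingDist_comm]
  triangle g h k := by
    unfold hammingMetric
    rw [← add_div]
    have := hammingDist_triangle (g : A → A) (h : A → A) (k : A → A)
    gcongr
    exact_mod_cast this
  mul_left a g h := by
    unfold hammingMetric
    congr 2
    exact hammingDist_comp (fun _ => a) (x := (g : A → A)) (y := (h : A → A))
      (fun _ => a.injective)
  mul_right a g h := by
    unfold hammingMetric
    congr 2
    refine Finset.card_bij (fun x _ => a x) ?_ (fun _ _ _ _ H => a.injective H) ?_
    · intro x hx
      exact Finset.mem_filter.2 ⟨Finset.mem_univ _, (Finset.mem_filter.1 hx).2⟩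
    · intro y hy
      refine ⟨a.symm y, Finset.mem_filter.2 ⟨Finset.mem_univ _, ?_⟩, by simp⟩
      simpa using (Finset.mem_filter.1 hy).2

theorem hammingMetric_le_one {A : Type v} [Fintype A] [DecidableEq A] (σ τ : Equiv.Perm A) :
    hammingMetric σ τ ≤ 1 := by
  unfold hammingMetric
  refine div_le_one_of_le₀ ?_ (by positivity)
  exact_mod_cast hammingDist_le_card_fintype

/-- The groups `Sym(n)` (those that are nontrivial) with the normalized Hamming metrics. -/
noncomputable def soficFamily : MetricFamily.{0, 0} where
  Idx := {n : ℕ // Nontrivial (Equiv.Perm (Fin n))}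
  G i := Equiv.Perm (Fin i.1)
  nontrivial i := i.2
  dist _ := hammingMetric
  isBiinvariantMetric := by
    rintro ⟨_ | n, hn⟩
    · exact absurd hn (not_nontrivial _)
    · exact isBiinvariantMetric_hammingMetric
  bounded := ⟨1, fun _ => hammingMetric_le_one⟩

/-- Sofic groups. -/
def IsSofic (Γ : Type w) [Group Γ] : Prop := soficFamily.IsApproximable Γ

end Sofic

section LinearSofic

variable (K : Type u) [Field K]

/-- The normalized rank metric on `GL_n(K)`. -/
noncomputable def rankMetric (n : ℕ) (M N : GL (Fin n) K) : ℝ :=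
  (((M : Matrix (Fin n) (Fin n) K) - (N : Matrix (Fin n) (Fin n) K)).rank : ℝ) / n

variable {K} in
theorem rank_eq_zero {n : ℕ} {A : Matrix (Fin n) (Fin n) K} (h : A.rank = 0) : A = 0 := by
  rw [Matrix.rank, Submodule.finrank_eq_zero, LinearMap.range_eq_bot] at h
  ext i j
  have := congrFun (LinearMap.congr_fun h (Pi.single j 1)) i
  simpa using this

variable {K} in
theorem rank_add_le {n : ℕ} (A B : Matrix (Fin n) (Fin n) K) :
    (A + B).rank ≤ A.rank + B.rank := by
  unfold Matrix.rank
  rw [Matrix.mulVecLin_add]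
  refine (Submodule.finrank_mono ?_).trans (Submodule.finrank_add_le_finrank_add_finrank _ _)
  exact LinearMap.range_add_le _ _

variable {K} in
theorem isBiinvariantMetric_rankMetric {n : ℕ} (hn : n ≠ 0) :
    IsBiinvariantMetric (rankMetric K n) where
  self g := by simp [rankMetric]
  eq_of_dist_eq_zero {g h} H := by
    have hr : ((g : Matrix (Fin n) (Fin n) K) - h).rank = 0 := by
      simpa [rankMetric, hn] using H
    exact Units.ext (sub_eq_zero.1 (rank_eq_zero hr))
  symm g h := by
    unfold rankMetric
    rw [← neg_sub (h : Matrix (Fin n) (Fin n) K), ← neg_one_mul,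
      Matrix.rank_mul_eq_right_of_isUnit_det]
    simp [Matrix.det_neg]
  triangle g h k := by
    unfold rankMetric
    rw [← add_div]
    have := rank_add_le (g.1 - h.1) (h.1 - k.1)
    rw [sub_add_sub_cancel] at this
    gcongr
    exact_mod_cast this
  mul_left a g h := by
    unfold rankMetric
    rw [Units.val_mul, Units.val_mul, ← mul_sub, Matrix.rank_mul_eq_right_of_isUnit_det]
    exact (Matrix.isUnit_iff_isUnit_det _).1 a.isUnit
  mul_right a g h := by
    unfold rankMetric
    rw [Units.val_mul, Units.val_mul, ← sub_mul, Matrix.rank_mul_eq_left_of_isUnit_det]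
    exact (Matrix.isUnit_iff_isUnit_det _).1 a.isUnit

theorem rankMetric_le_one (n : ℕ) (M N : GL (Fin n) K) : rankMetric K n M N ≤ 1 := by
  unfold rankMetric
  refine div_le_one_of_le₀ ?_ (by positivity)
  exact_mod_cast Matrix.rank_le_height _

/-- The groups `GL_n(K)` (those that are nontrivial) with the normalized rank metrics. -/
noncomputable def linearSoficFamily : MetricFamily.{0, u} where
  Idx := {n : ℕ // Nontrivial (GL (Fin n) K)}
  G i := GL (Fin i.1) K
  nontrivial i := i.2
  dist i := rankMetric K i.1
  isBiinvariantMetric := by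
    rintro ⟨n, hn⟩
    refine isBiinvariantMetric_rankMetric ?_
    rintro rfl
    exact absurd hn (not_nontrivial _)
  bounded := ⟨1, fun i => rankMetric_le_one K i.1⟩

/-- `K`-linear sofic groups. -/
def IsLinearSofic (Γ : Type w) [Group Γ] : Prop := (linearSoficFamily K).IsApproximable Γ

end LinearSofic

section Hyperlinear

/-- The normalized Hilbert-Schmidt metric on `U(n)`. -/
noncomputable def hsMetric (n : ℕ) (A B : Matrix.unitaryGroup (Fin n) ℂ) : ℝ :=
  √((1 / n : ℝ) * ∑ i, ∑ j, ‖A.1 i j - B.1 i j‖ ^ 2)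

/-- The Euclidean norm of a square matrix. -/
noncomputable def euclNorm {n : ℕ} (X : Matrix (Fin n) (Fin n) ℂ) : ℝ :=
  ‖WithLp.toLp 2 (fun p : Fin n × Fin n => X p.1 p.2)‖

theorem euclNorm_eq {n : ℕ} (X : Matrix (Fin n) (Fin n) ℂ) :
    euclNorm X = √(∑ i, ∑ j, ‖X i j‖ ^ 2) := by
  rw [euclNorm, EuclideanSpace.norm_eq, Fintype.sum_prod_type]

theorem euclNorm_add_le {n : ℕ} (X Y : Matrix (Fin n) (Fin n) ℂ) :
    euclNorm (X + Y) ≤ euclNorm X + euclNorm Y :=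
  norm_add_le (WithLp.toLp 2 (fun p : Fin n × Fin n => X p.1 p.2))
    (WithLp.toLp 2 (fun p : Fin n × Fin n => Y p.1 p.2))

theorem sum_sq_eq_trace {n : ℕ} (X : Matrix (Fin n) (Fin n) ℂ) :
    ((∑ i, ∑ j, ‖X i j‖ ^ 2 : ℝ) : ℂ) = (X * star X).trace := by
  simp [Matrix.trace, Matrix.mul_apply, Matrix.star_apply, Complex.mul_conj,
    Complex.normSq_eq_norm_sq]

theorem euclNorm_mul_left {n : ℕ} (U : Matrix.unitaryGroup (Fin n) ℂ)
    (X : Matrix (Fin n) (Fin n) ℂ) : euclNorm (U.1 * X) = euclNorm X := by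
  rw [euclNorm_eq, euclNorm_eq]
  congr 1
  apply Complex.ofReal_injective
  rw [sum_sq_eq_trace, sum_sq_eq_trace, star_mul, ← mul_assoc, Matrix.trace_mul_comm,
    ← mul_assoc, ← mul_assoc, Matrix.UnitaryGroup.star_mul_self, one_mul]

theorem euclNorm_mul_right {n : ℕ} (U : Matrix.unitaryGroup (Fin n) ℂ)
    (X : Matrix (Fin n) (Fin n) ℂ) : euclNorm (X * U.1) = euclNorm X := by
  rw [euclNorm_eq, euclNorm_eq]
  congr 1
  apply Complex.ofReal_injective
  rw [sum_sq_eq_trace, sum_sq_eq_trace, star_mul, mul_assoc, ← mul_assoc U.1,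
    Matrix.mem_unitaryGroup_iff.1 U.2, one_mul]

theorem hsMetric_eq {n : ℕ} (A B : Matrix.unitaryGroup (Fin n) ℂ) :
    hsMetric n A B = √(1 / n : ℝ) * euclNorm (A.1 - B.1) := by
  rw [hsMetric, Real.sqrt_mul (by positivity), euclNorm_eq]
  rfl

theorem isBiinvariantMetric_hsMetric {n : ℕ} (hn : n ≠ 0) :
    IsBiinvariantMetric (hsMetric n) where
  self g := by simp [hsMetric]
  eq_of_dist_eq_zero {g h} H := by
    have h0 : √(1 / n : ℝ) ≠ 0 := by positivity
    rw [hsMetric_eq] at H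
    have H2 := norm_eq_zero.1 ((mul_eq_zero.1 H).resolve_left h0)
    refine Subtype.ext (Matrix.ext fun i j => sub_eq_zero.1 ?_)
    exact congrFun (congrArg WithLp.ofLp H2) (i, j)
  symm g h := by
    unfold hsMetric
    simp only [norm_sub_rev]
  triangle g h k := by
    simp only [hsMetric_eq]
    rw [← mul_add, ← sub_add_sub_cancel g.1 h.1 k.1]
    gcongr
    exact euclNorm_add_le _ _
  mul_left a g h := by
    simp only [hsMetric_eq, Matrix.UnitaryGroup.mul_val, ← mul_sub, euclNorm_mul_left]
  mul_right a g h := by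
    simp only [hsMetric_eq, Matrix.UnitaryGroup.mul_val, ← sub_mul, euclNorm_mul_right]

theorem hsMetric_le_two (n : ℕ) (A B : Matrix.unitaryGroup (Fin n) ℂ) : hsMetric n A B ≤ 2 := by
  rcases Nat.eq_zero_or_pos n with rfl | hn
  · simp [hsMetric]
  have key : ∀ U : Matrix.unitaryGroup (Fin n) ℂ, euclNorm U.1 = √n := by
    intro U
    rw [euclNorm_eq]
    congr 1
    apply Complex.ofReal_injective
    rw [sum_sq_eq_trace, Matrix.mem_unitaryGroup_iff.1 U.2]
    simp
  have hB : euclNorm (-B.1) = √n := by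
    rw [← key B, euclNorm_eq, euclNorm_eq]
    simp
  have h1 : euclNorm (A.1 - B.1) ≤ √n + √n := by
    rw [sub_eq_add_neg]
    exact (euclNorm_add_le _ _).trans (by rw [key, hB])
  rw [hsMetric_eq]
  have h2 : √(1 / n : ℝ) * √n = 1 := by
    rw [← Real.sqrt_mul (by positivity), one_div_mul_cancel (by positivity), Real.sqrt_one]
  calc √(1 / n : ℝ) * euclNorm (A.1 - B.1) ≤ √(1 / n : ℝ) * (√n + √n) := by gcongr
    _ = 2 := by rw [mul_add, h2]; norm_num

/-- The groups `U(n)` (those that are nontrivial) with the normalized Hilbert-Schmidt metrics. -/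
noncomputable def hyperlinearFamily : MetricFamily.{0, 0} where
  Idx := {n : ℕ // Nontrivial (Matrix.unitaryGroup (Fin n) ℂ)}
  G i := Matrix.unitaryGroup (Fin i.1) ℂ
  nontrivial i := i.2
  dist i := hsMetric i.1
  isBiinvariantMetric := by
    rintro ⟨n, hn⟩
    refine isBiinvariantMetric_hsMetric ?_
    rintro rfl
    exact absurd hn (not_nontrivial _)
  bounded := ⟨2, fun i => hsMetric_le_two i.1⟩

/-- Hyperlinear groups. -/
def IsHyperlinear (Γ : Type w) [Group Γ] : Prop := hyperlinearFamily.IsApproximable Γ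

end Hyperlinear

section WeaklySofic

/-- A finite group with a bi-invariant metric of diameter one. -/
structure FiniteMetricGroup where
  /-- the group -/
  carrier : Type
  [group : Group carrier]
  [finite : Finite carrier]
  /-- the metric -/
  dist : carrier → carrier → ℝ
  isBiinvariantMetric : IsBiinvariantMetric dist
  dist_le_one : ∀ g h, dist g h ≤ 1
  exists_dist_eq_one : ∃ g h, dist g h = 1

attribute [instance] FiniteMetricGroup.group FiniteMetricGroup.finite

/-- All finite groups equipped with bi-invariant metrics of diameter one. -/
def weaklySoficFamily : MetricFamily.{1, 0} where
  Idx := FiniteMetricGroup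
  G i := i.carrier
  nontrivial i := by
    obtain ⟨g, h, hgh⟩ := i.exists_dist_eq_one
    refine ⟨g, h, ?_⟩
    rintro rfl
    rw [i.isBiinvariantMetric.self] at hgh
    exact zero_ne_one hgh
  dist i := i.dist
  isBiinvariantMetric i := i.isBiinvariantMetric
  bounded := ⟨1, fun i => i.dist_le_one⟩

/-- Weakly sofic groups. -/
def IsWeaklySofic (Γ : Type w) [Group Γ] : Prop := weaklySoficFamily.IsApproximable Γ

end WeaklySofic

section SoficActions

variable {Γ : Type u} [Group Γ] {Δ : Type v} [Group Δ]

/-- The restriction of `π` to `E` is an injective partial homomorphism `E ↪ Λ`. -/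
def IsInjPartialHomOn {Λ : Type w} [Group Λ] (E : Finset Δ) (π : Δ → Λ) : Prop :=
  Set.InjOn π (E : Set Δ) ∧ ∀ g ∈ E, ∀ h ∈ E, g * h ∈ E → π (g * h) = π g * π h

/-- `φ` is an `(F, E, ε, Λ)`-automorphic approximation of `β`. Only the values of `π s` on `E`
for `s ∈ S` matter. -/
def IsAutomorphicApprox (β : Γ →* MulAut Δ) {A : Type} [Fintype A] (φ : Γ → Equiv.Perm A)
    (F : Finset Γ) (E : Finset Δ) (ε : ℝ) (Λ : Type w) [Group Λ] : Prop :=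
  ∃ (S : Finset A) (π : A → Δ → Λ),
    (1 - ε) * (Fintype.card A : ℝ) < (S.card : ℝ) ∧
    (∀ s ∈ S, IsInjPartialHomOn E (π s)) ∧
    ∀ g ∈ F, ∀ h ∈ E, ∀ s ∈ S, φ g s ∈ S → (β g)⁻¹ h ∈ E →
      π (φ g s) h = π s ((β g)⁻¹ h)

/-- `β` is a sofic `C`-action by automorphisms, for a class `C` of groups. -/
def IsSoficAction (C : ∀ (Λ : Type w) [Group Λ], Prop) (β : Γ →* MulAut Δ) : Prop :=
  ∀ (F : Finset Γ) (E : Finset Δ) (ε : ℝ), 0 < ε →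
    ∃ (Λ : Type w) (_ : Group Λ) (A : Type) (_ : Fintype A) (_ : DecidableEq A)
      (φ : Γ → Equiv.Perm A),
      C Λ ∧ IsUnital φ ∧ IsMultiplicativeOn hammingMetric F ε φ ∧
        IsAutomorphicApprox β φ F E ε Λ

end SoficActions

end MetricApprox

/-!
Amplification is the key: tensoring a representation with itself expands small lengths, so the
separating constant of an approximable group may be taken to be a universal one. Hence the
approximations of the varying groups `Λ` supplied by a sofic action separate uniformly, and on the
coordinates over `S` the maps `π_s` turn an approximation `ψ` of `Λ` into an element
`(ψ (π_a δ))_a` of the permutational wreath product of a group of the family by `Sym(A)`. Together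
with the permutation `φ g` it is an approximation of `(δ, g)`, because equivariance of the `π_s`
is what multiplication in the wreath product asks for. It separates `Δ`; juxtaposing it with an
approximation of `Γ` separates the whole semidirect product. Each of the four families represents
the wreath products of its members by finite symmetric groups, with lengths controlled by averages.
-/

namespace MetricApprox

open scoped BigOperators Kronecker

section BiinvariantMetric

variable {G : Type v} [Group G] {d : G → G → ℝ}

theorem IsBiinvariantMetric.nonneg (hd : IsBiinvariantMetric d) (g h : G) : 0 ≤ d g h := by
  have := hd.triangle g h g
  rw [hd.self, hd.symm h g] at this
  linarith

theorem IsBiinvariantMetric.dist_eq_dist_mul_inv_one (hd : IsBiinvariantMetric d) (g h : G) :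
    d g h = d (g * h⁻¹) 1 := by
  rw [← hd.mul_right h⁻¹ g h, mul_inv_cancel]

theorem IsBiinvariantMetric.dist_map_eq_dist_map_one {H : Type w} [Group H]
    (hd : IsBiinvariantMetric d) (f : H →* G) (x y : H) : d (f x) (f y) = d (f (x * y⁻¹)) 1 := by
  rw [hd.dist_eq_dist_mul_inv_one, map_mul, map_inv]

theorem IsBiinvariantMetric.dist_mul_mul_le (hd : IsBiinvariantMetric d) (a b a' b' : G) :
    d (a * b) (a' * b') ≤ d a a' + d b b' := by
  have := hd.triangle (a * b) (a' * b) (a' * b')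
  rwa [hd.mul_right, hd.mul_left] at this

end BiinvariantMetric

section Representations

variable {G : Type*} [Group G] {G' : Type*} [Group G'] {H : Type*} [Group H] {H' : Type*} [Group H']

/-- The unrestricted permutational wreath product of `G` by `Sym(A)`. -/
abbrev PermWreath (A G : Type*) [Group G] : Type _ := (A → G) ⋊[mulAutArrow] Equiv.Perm A

/-- A representation of the permutational wreath product of a group `G` with length function `l` by
`Sym(A)` in a group with length function `m`, under which functions `A → G` have a length comparable
to the average of their lengths and permutations a length controlled by the Hamming metric. The
squares accommodate the Hilbert-Schmidt metric, which is a quadratic mean. -/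
structure WreathRep (l : G → ℝ) (A : Type*) [Fintype A] [DecidableEq A] (m : H → ℝ) where
  hom : PermWreath A G →* H
  expect_le : ∀ f : A → G, 𝔼 a, l (f a) ≤ m (hom (.inl f))
  sq_inl_le : ∀ f : A → G, m (hom (.inl f)) ^ 2 ≤ 2 * 𝔼 a, l (f a)
  sq_inr_le : ∀ σ : Equiv.Perm A, m (hom (.inr σ)) ^ 2 ≤ 2 * hammingMetric σ 1

/-- A representation of a product of two groups with length functions `l` and `l'` in a group with
length function `m`, isometric on each factor. For linear groups it is the tensor product. -/
structure ProductRep (l : G → ℝ) (l' : G' → ℝ) (m : H → ℝ) where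
  hom : G × G' →* H
  length_left : ∀ x, m (hom (x, 1)) = l x
  length_right : ∀ y, m (hom (1, y)) = l' y

variable {l : G → ℝ} {l' : G' → ℝ} {m : H → ℝ} {m' : H' → ℝ}

/-- Composition of a representation of a wreath product with an isometric homomorphism. -/
def WreathRep.mapIsometry {A : Type*} [Fintype A] [DecidableEq A] (W : WreathRep l A m)
    (e : H →* H') (he : ∀ x, m' (e x) = m x) : WreathRep l A m' where
  hom := e.comp W.hom
  expect_le f := by simpa only [MonoidHom.comp_apply, he] using W.expect_le f
  sq_inl_le f := by simpa only [MonoidHom.comp_apply, he] using W.sq_inl_le f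
  sq_inr_le σ := by simpa only [MonoidHom.comp_apply, he] using W.sq_inr_le σ

/-- Composition of a representation of a product with an isometric homomorphism. -/
def ProductRep.mapIsometry (T : ProductRep l l' m) (e : H →* H') (he : ∀ x, m' (e x) = m x) :
    ProductRep l l' m' where
  hom := e.comp T.hom
  length_left x := by simpa only [MonoidHom.comp_apply, he] using T.length_left x
  length_right y := by simpa only [MonoidHom.comp_apply, he] using T.length_right y

end Representations

namespace MetricFamily

variable (𝒢 : MetricFamily.{u, v})

/-- The length of an element of a group of the family: its distance to the identity. -/
def len (i : 𝒢.Idx) (g : 𝒢.G i) : ℝ := 𝒢.dist i g 1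

/-- The group `H` with length function `m` embeds isometrically in some group of the family. -/
def Represents {H : Type*} [Group H] (m : H → ℝ) : Prop :=
  ∃ (k : 𝒢.Idx) (e : H →* 𝒢.G k), ∀ x, 𝒢.len k (e x) = m x

/-- The family represents permutational wreath products and products of its members, in such a way
that the diagonal of some product `G i × G i` expands small lengths. The constant `5 / 4` suits all
four families at once; for the Hilbert-Schmidt metric no constant above `√2` would do. -/
structure IsWreathClosed : Prop where
  exists_wreathRep : ∀ (i : 𝒢.Idx) (A : Type) [Fintype A] [DecidableEq A] [Nonempty A],
    ∃ k, Nonempty (WreathRep (𝒢.len i) A (𝒢.len k))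
  exists_productRep : ∀ i i', ∃ k, Nonempty (ProductRep (𝒢.len i) (𝒢.len i') (𝒢.len k))
  exists_expanding_productRep : ∀ i, ∃ (k : 𝒢.Idx)
    (T : ProductRep (𝒢.len i) (𝒢.len i) (𝒢.len k)),
    ∀ x, 𝒢.len i x ≤ 1 / 6 → 5 / 4 * 𝒢.len i x ≤ 𝒢.len k (T.hom (x, x))

variable {𝒢}

theorem len_nonneg {i : 𝒢.Idx} (g : 𝒢.G i) : 0 ≤ 𝒢.len i g :=
  (𝒢.isBiinvariantMetric i).nonneg g 1

theorem len_mul_le {i : 𝒢.Idx} (g h : 𝒢.G i) : 𝒢.len i (g * h) ≤ 𝒢.len i g + 𝒢.len i h := by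
  simpa only [len, mul_one] using (𝒢.isBiinvariantMetric i).dist_mul_mul_le g h 1 1

theorem dist_eq_len {i : 𝒢.Idx} (g h : 𝒢.G i) : 𝒢.dist i g h = 𝒢.len i (g * h⁻¹) :=
  (𝒢.isBiinvariantMetric i).dist_eq_dist_mul_inv_one g h

theorem dist_map_eq_len {H : Type*} [Group H] {i : 𝒢.Idx} (f : H →* 𝒢.G i) (x y : H) :
    𝒢.dist i (f x) (f y) = 𝒢.len i (f (x * y⁻¹)) :=
  (𝒢.isBiinvariantMetric i).dist_map_eq_dist_map_one f x y

theorem IsApproximableWith.mono {c c' : ℝ} {Γ : Type w} [Group Γ] (hc : c' ≤ c)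
    (h : 𝒢.IsApproximableWith c Γ) : 𝒢.IsApproximableWith c' Γ := by
  intro F ε hε
  obtain ⟨i, φ, hmul, hsep, hone⟩ := h F ε hε
  exact ⟨i, φ, hmul, fun g hg hg1 => hc.trans_lt (hsep g hg hg1), hone⟩

section Product

theorem len_productRep_diagonal_le {i k : 𝒢.Idx}
    (T : ProductRep (𝒢.len i) (𝒢.len i) (𝒢.len k)) (x : 𝒢.G i) :
    𝒢.len k (T.hom (x, x)) ≤ 2 * 𝒢.len i x := by
  calc 𝒢.len k (T.hom (x, x)) = 𝒢.len k (T.hom (x, 1) * T.hom (1, x)) := by simp [← map_mul]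
    _ ≤ 𝒢.len k (T.hom (x, 1)) + 𝒢.len k (T.hom (1, x)) := len_mul_le _ _
    _ = 2 * 𝒢.len i x := by rw [T.length_left, T.length_right, two_mul]

/-- Both groups embed isometrically in a common one, of which two copies are juxtaposed by means of
the wreath product over a set with two elements. -/
theorem IsWreathClosed.exists_average_hom (h𝒢 : 𝒢.IsWreathClosed) (i i' : 𝒢.Idx) :
    ∃ (k : 𝒢.Idx) (Q : 𝒢.G i × 𝒢.G i' →* 𝒢.G k), ∀ x,
      (𝒢.len i x.1 + 𝒢.len i' x.2) / 2 ≤ 𝒢.len k (Q x) ∧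
      𝒢.len k (Q x) ^ 2 ≤ 𝒢.len i x.1 + 𝒢.len i' x.2 := by
  obtain ⟨j, ⟨T⟩⟩ := h𝒢.exists_productRep i i'
  obtain ⟨k, ⟨W⟩⟩ := h𝒢.exists_wreathRep j Bool
  let coord : 𝒢.G i × 𝒢.G i' →* Bool → 𝒢.G j := MonoidHom.pi fun b =>
    b.rec (T.hom.comp ((MonoidHom.inl _ _).comp (MonoidHom.fst _ _)))
      (T.hom.comp ((MonoidHom.inr _ _).comp (MonoidHom.snd _ _)))
  have expect_len_coord (x) :
      𝔼 b, 𝒢.len j (coord x b) = (𝒢.len i x.1 + 𝒢.len i' x.2) / 2 := by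
    have len_true : 𝒢.len j (coord x true) = 𝒢.len i' x.2 := T.length_right x.2
    have len_false : 𝒢.len j (coord x false) = 𝒢.len i x.1 := T.length_left x.1
    rw [Fintype.expect_eq_sum_div_card, Fintype.sum_bool, len_true, len_false, add_comm]
    simp
  refine ⟨k, W.hom.comp (SemidirectProduct.inl.comp coord), fun x => ⟨?_, ?_⟩⟩
  · exact (expect_len_coord x).ge.trans (W.expect_le (coord x))
  · refine (W.sq_inl_le (coord x)).trans_eq ?_
    rw [expect_len_coord, mul_div_cancel₀ _ two_ne_zero]

end Product

section Amplification

theorem IsWreathClosed.exists_amplifying_hom (h𝒢 : 𝒢.IsWreathClosed) (i : 𝒢.Idx) :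
    ∃ (k : 𝒢.Idx) (θ : 𝒢.G i →* 𝒢.G k), ∀ x,
      𝒢.len k (θ x) ^ 2 ≤ 3 * 𝒢.len i x ∧
      min (9 / 8 * 𝒢.len i x) (1 / 12) ≤ 𝒢.len k (θ x) := by
  obtain ⟨j, T, hT⟩ := h𝒢.exists_expanding_productRep i
  obtain ⟨k, Q, hQ⟩ := h𝒢.exists_average_hom i j
  let diag : 𝒢.G i →* 𝒢.G j := T.hom.comp ((MonoidHom.id _).prod (MonoidHom.id _))
  refine ⟨k, Q.comp ((MonoidHom.id _).prod diag), fun x => ?_⟩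
  have diag_le : 𝒢.len j (diag x) ≤ 2 * 𝒢.len i x := len_productRep_diagonal_le T x
  obtain ⟨le_len, sq_len_le⟩ : (𝒢.len i x + 𝒢.len j (diag x)) / 2 ≤ 𝒢.len k (Q (x, diag x)) ∧
    𝒢.len k (Q (x, diag x)) ^ 2 ≤ 𝒢.len i x + 𝒢.len j (diag x) := hQ (x, diag x)
  refine ⟨sq_len_le.trans (by linarith), le_trans ?_ le_len⟩
  rcases le_total (𝒢.len i x) (1 / 6) with hx | hx
  · have expanded : 5 / 4 * 𝒢.len i x ≤ 𝒢.len j (diag x) := hT x hx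
    exact (min_le_left _ _).trans (by linarith)
  · have := len_nonneg (diag x)
    exact (min_le_right _ _).trans (by linarith)

variable {Γ : Type w} [Group Γ]

theorem IsApproximableWith.amplify (h𝒢 : 𝒢.IsWreathClosed) {c : ℝ} (hc : c < 2 / 27)
    (h : 𝒢.IsApproximableWith c Γ) : 𝒢.IsApproximableWith (9 / 8 * c) Γ := by
  intro F ε hε
  obtain ⟨i, φ, hmul, hsep, hone⟩ := h F (ε ^ 2 / 3) (by positivity)
  obtain ⟨k, θ, hθ⟩ := h𝒢.exists_amplifying_hom i
  refine ⟨k, θ ∘ φ, fun g hg h hh hgh => ?_, fun g hg hg1 => ?_, ?_⟩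
  · refine lt_of_pow_lt_pow_left₀ 2 hε.le ?_
    have := hmul g hg h hh hgh
    rw [dist_eq_len] at this
    calc 𝒢.dist k (θ (φ (g * h))) (θ (φ g) * θ (φ h)) ^ 2
        = 𝒢.len k (θ (φ (g * h) * (φ g * φ h)⁻¹)) ^ 2 := by rw [← map_mul, dist_map_eq_len]
      _ ≤ 3 * 𝒢.len i (φ (g * h) * (φ g * φ h)⁻¹) := (hθ _).1
      _ < ε ^ 2 := by linarith
  · have : c < 𝒢.len i (φ g) := hsep g hg hg1
    exact (lt_min (by linarith) (by linarith)).trans_le (hθ (φ g)).2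
  · rw [IsUnital, Function.comp_apply, show φ 1 = 1 from hone, map_one]

theorem IsApproximable.isApproximableWith (h𝒢 : 𝒢.IsWreathClosed) (h : 𝒢.IsApproximable Γ) :
    𝒢.IsApproximableWith (1 / 16) Γ := by
  obtain ⟨c, hc, happrox⟩ := h
  have happrox_min (n : ℕ) : 𝒢.IsApproximableWith (min ((9 / 8) ^ n * c) (1 / 16)) Γ := by
    induction n with
    | zero => exact happrox.mono (by simp)
    | succ n ih =>
      refine (ih.amplify h𝒢 ((min_le_right _ _).trans_lt (by norm_num))).mono ?_
      rw [mul_min_of_nonneg _ _ (by norm_num), pow_succ', mul_assoc]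
      exact min_le_min_left _ (by norm_num)
  obtain ⟨n, hn⟩ := pow_unbounded_of_one_lt (1 / 16 / c) (by norm_num : (1 : ℝ) < 9 / 8)
  exact (happrox_min n).mono (le_min ((div_lt_iff₀ hc).1 hn).le le_rfl)

end Amplification

section Extension

variable {Γ : Type w} [Group Γ] {Γ' : Type x} [Group Γ']

/-- `Γ` is `(𝒢, c)`-approximable by maps which are required to separate only the elements of the
subgroup `N`. -/
def IsApproximableAlong (𝒢 : MetricFamily.{u, v}) (c : ℝ) (N : Subgroup Γ) : Prop :=
  ∀ (F : Finset Γ) (ε : ℝ), 0 < ε → ∃ (i : 𝒢.Idx) (φ : Γ → 𝒢.G i),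
    IsMultiplicativeOn (𝒢.dist i) F ε φ ∧ (∀ g ∈ F, g ∈ N → g ≠ 1 → c < 𝒢.dist i (φ g) 1) ∧
      IsUnital φ

theorem IsApproximableAlong.isApproximableWith (h𝒢 : 𝒢.IsWreathClosed) {c : ℝ} {p : Γ' →* Γ}
    (hker : 𝒢.IsApproximableAlong c p.ker) (hΓ : 𝒢.IsApproximableWith c Γ) :
    𝒢.IsApproximableWith (c / 2) Γ' := by
  classical
  intro F ε hε
  obtain ⟨i, χ, χ_mul, χ_sep, χ_one⟩ := hker F (ε ^ 2 / 2) (by positivity)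
  obtain ⟨i', ρ, ρ_mul, ρ_sep, ρ_one⟩ := hΓ (F.image p) (ε ^ 2 / 2) (by positivity)
  obtain ⟨k, Q, hQ⟩ := h𝒢.exists_average_hom i i'
  have hpF {g} (hg : g ∈ F) : p g ∈ F.image p := Finset.mem_image_of_mem _ hg
  refine ⟨k, fun g => Q (χ g, ρ (p g)), fun g hg h hh hgh => ?_, fun g hg hg1 => ?_, ?_⟩
  · refine lt_of_pow_lt_pow_left₀ 2 hε.le ?_
    have hχ := χ_mul g hg h hh hgh
    have hρ := ρ_mul (p g) (hpF hg) (p h) (hpF hh) (map_mul p g h ▸ hpF hgh)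
    rw [← map_mul, dist_map_eq_len]
    refine (hQ _).2.trans_lt ?_
    simp only [Prod.mk_mul_mk, Prod.inv_mk, ← dist_eq_len, map_mul]
    linarith
  · refine lt_of_lt_of_le ?_ (hQ _).1
    have hχ := len_nonneg (χ g)
    have hρ := len_nonneg (ρ (p g))
    by_cases hg_ker : p g = 1
    · have : c < 𝒢.len i (χ g) := χ_sep g hg (MonoidHom.mem_ker.2 hg_ker) hg1
      linarith
    · have : c < 𝒢.len i' (ρ (p g)) := ρ_sep (p g) (hpF hg) hg_ker
      linarith
  · rw [IsUnital, map_one, show χ 1 = 1 from χ_one, show ρ 1 = 1 from ρ_one, Prod.mk_one_one,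
      map_one]

end Extension

section Wreath

theorem dist_wreathRep_le {i j : 𝒢.Idx} {A : Type*} [Fintype A] [DecidableEq A] [Nonempty A]
    (W : WreathRep (𝒢.len i) A (𝒢.len j)) (x y : PermWreath A (𝒢.G i)) :
    𝒢.dist j (W.hom x) (W.hom y) ≤
      √(2 * 𝔼 a, 𝒢.dist i (x.left a) (y.left a)) + √(2 * hammingMetric x.right y.right) := by
  nth_rw 1 [← SemidirectProduct.inl_left_mul_inr_right x,
    ← SemidirectProduct.inl_left_mul_inr_right y]
  rw [map_mul, map_mul]
  refine ((𝒢.isBiinvariantMetric j).dist_mul_mul_le _ _ _ _).trans (add_le_add ?_ ?_)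
  · rw [dist_map_eq_len, ← map_inv, ← map_mul]
    simp only [dist_eq_len]
    exact Real.le_sqrt_of_sq_le (W.sq_inl_le _)
  · rw [dist_map_eq_len, ← map_inv, ← map_mul,
      isBiinvariantMetric_hammingMetric.dist_eq_dist_mul_inv_one]
    exact Real.le_sqrt_of_sq_le (W.sq_inr_le _)

end Wreath

end MetricFamily

section Averages

variable {A : Type*} [Fintype A] {S : Finset A} {x : A → ℝ}

theorem expect_le_of_forall_mem_le [Nonempty A] {b K η : ℝ} (hb : 0 ≤ b) (hK : 0 ≤ K)
    (hS : (1 - η) * Fintype.card A ≤ S.card) (hxb : ∀ s ∈ S, x s ≤ b) (hxK : ∀ a, x a ≤ K) :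
    𝔼 a, x a ≤ b + η * K := by
  classical
  have card_compl : (Sᶜ.card : ℝ) = Fintype.card A - S.card := by
    rw [Finset.card_compl, Nat.cast_sub (Finset.card_le_univ _)]
  have card_le : (S.card : ℝ) ≤ Fintype.card A := by exact_mod_cast Finset.card_le_univ S
  rw [Fintype.expect_eq_sum_div_card, div_le_iff₀ (by positivity)]
  calc ∑ a, x a = ∑ a ∈ S, x a + ∑ a ∈ Sᶜ, x a := (Finset.sum_add_sum_compl S x).symm
    _ ≤ S.card * b + Sᶜ.card * K := by
      refine add_le_add ?_ ?_
      · simpa using Finset.sum_le_sum hxb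
      · simpa using Finset.sum_le_sum fun a (_ : a ∈ Sᶜ) => hxK a
    _ ≤ Fintype.card A * b + η * Fintype.card A * K := by
      rw [card_compl]
      gcongr
      linarith
    _ = (b + η * K) * Fintype.card A := by ring

theorem half_lt_expect {c : ℝ} (hc : 0 ≤ c) (hS : (Fintype.card A : ℝ) / 2 < S.card)
    (hxc : ∀ s ∈ S, c < x s) (hx : ∀ a, 0 ≤ x a) : c / 2 < 𝔼 a, x a := by
  have S_card_pos : (0 : ℝ) < S.card := hS.trans_le' (by positivity)
  have S_nonempty : S.Nonempty := by simpa using S_card_pos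
  have card_pos : (0 : ℝ) < Fintype.card A := by
    exact S_card_pos.trans_le (by exact_mod_cast Finset.card_le_univ S)
  rw [Fintype.expect_eq_sum_div_card, lt_div_iff₀ card_pos]
  calc c / 2 * Fintype.card A = Fintype.card A / 2 * c := by ring
    _ ≤ S.card * c := by gcongr
    _ < ∑ s ∈ S, x s := by simpa using Finset.sum_lt_sum_of_nonempty S_nonempty hxc
    _ ≤ ∑ a, x a := Finset.sum_le_univ_sum_of_nonneg hx

theorem card_inter_map_perm_ge [DecidableEq A] (S : Finset A) (σ : Equiv.Perm A) {η : ℝ}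
    (hS : (1 - η) * Fintype.card A ≤ S.card) :
    (1 - 2 * η) * Fintype.card A ≤ (S ∩ S.map σ.toEmbedding).card := by
  have inclusion_exclusion := Finset.card_union_add_card_inter S (S.map σ.toEmbedding)
  have union_le := Finset.card_le_univ (S ∪ S.map σ.toEmbedding)
  rw [Finset.card_map] at inclusion_exclusion
  have : (S.card + S.card : ℝ) ≤ (S ∩ S.map σ.toEmbedding).card + Fintype.card A := by
    exact_mod_cast (by omega :
      S.card + S.card ≤ (S ∩ S.map σ.toEmbedding).card + Fintype.card A)
  linarith

theorem expect_le_of_forall_map_mem_le [Nonempty A] (σ : Equiv.Perm A) {b K η : ℝ} (hb : 0 ≤ b)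
    (hK : 0 ≤ K) (hS : (1 - η) * Fintype.card A ≤ S.card)
    (hxb : ∀ s ∈ S, σ s ∈ S → x (σ s) ≤ b) (hxK : ∀ a, x a ≤ K) :
    𝔼 a, x a ≤ b + 2 * η * K := by
  classical
  refine expect_le_of_forall_mem_le hb hK (card_inter_map_perm_ge S σ hS) (fun a ha => ?_) hxK
  obtain ⟨ha, s, hs, rfl⟩ := by simpa only [Finset.mem_inter, Finset.mem_map] using ha
  exact hxb s hs ha

end Averages

theorem exists_tolerance {ε : ℝ} (hε : 0 < ε) (K : ℝ) :
    ∃ η : ℝ, 0 < η ∧ η < 1 / 2 ∧ √(2 * (η + 2 * η * K)) + √(2 * η) < ε := by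
  have tendsto_zero : Filter.Tendsto (fun η : ℝ => √(2 * (η + 2 * η * K)) + √(2 * η))
      (nhdsWithin 0 (Set.Ioi 0)) (nhds 0) := by
    refine (Continuous.tendsto' ?_ 0 0 (by simp)).mono_left nhdsWithin_le_nhds
    fun_prop
  have eventually_small := tendsto_zero.eventually_lt_const hε
  obtain ⟨η, hηε, hη0, hη⟩ :=
    (eventually_small.and (Ioo_mem_nhdsGT (by norm_num : (0 : ℝ) < 1 / 2))).exists
  exact ⟨η, hη0, hη, hηε⟩

section SemidirectProduct

/-- The function on `A` by which `e` is represented in a wreath product: the approximation `ψ` of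
`Λ` applied to the images of `e` under the `π a`, and `1` off the set `S` where these are
controlled. -/
noncomputable def coordinates {A Δ Λ G : Type*} [One G] (S : Finset A) (π : A → Δ → Λ) (ψ : Λ → G)
    (e : Δ) (a : A) : G :=
  open Classical in if a ∈ S then ψ (π a e) else 1

theorem coordinates_of_mem {A Δ Λ G : Type*} [One G] {S : Finset A} {a : A} (ha : a ∈ S)
    (π : A → Δ → Λ) (ψ : Λ → G) (e : Δ) : coordinates S π ψ e a = ψ (π a e) :=
  if_pos ha

variable {Γ : Type w} [Group Γ] {Δ : Type x} [Group Δ]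

theorem IsSoficAction.mono {C C' : ∀ (Λ : Type u) [Group Λ], Prop} {β : Γ →* MulAut Δ}
    (hC : ∀ (Λ : Type u) [Group Λ], C Λ → C' Λ) (hβ : IsSoficAction C β) :
    IsSoficAction C' β := by
  intro F E ε hε
  obtain ⟨Λ, _, A, _, _, φ, hΛ, hφ⟩ := hβ F E ε hε
  exact ⟨Λ, _, A, _, _, φ, hC Λ hΛ, hφ⟩

theorem IsInjPartialHomOn.map_one {Λ : Type*} [Group Λ] {E : Finset Δ} {π : Δ → Λ}
    (hπ : IsInjPartialHomOn E π) (hE : 1 ∈ E) : π 1 = 1 := by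
  simpa using hπ.2 1 hE 1 hE (by simpa using hE)

theorem IsInjPartialHomOn.map_ne_one {Λ : Type*} [Group Λ] {E : Finset Δ} {π : Δ → Λ}
    (hπ : IsInjPartialHomOn E π) (hE : 1 ∈ E) {e : Δ} (he : e ∈ E) (he1 : e ≠ 1) : π e ≠ 1 :=
  fun h => he1 (hπ.1 he hE (h.trans (hπ.map_one hE).symm))

theorem exists_finset_left_mem (β : Γ →* MulAut Δ) (F : Finset (Δ ⋊[β] Γ)) :
    ∃ E : Finset Δ, 1 ∈ E ∧ (∀ g ∈ F, g.left ∈ E) ∧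
      ∀ g ∈ F, ∀ h ∈ F, β g.right h.left ∈ E := by
  classical
  refine ⟨{1} ∪ F.image (·.left) ∪ Finset.image₂ (fun g h => β g.right h.left) F F,
    by simp, fun g hg => ?_, fun g hg h hh => ?_⟩
  · exact Finset.mem_union_left _ (Finset.mem_union_right _ (Finset.mem_image_of_mem _ hg))
  · exact Finset.mem_union_right _ (Finset.mem_image₂_of_mem hg hh)

theorem coordinates_one {A Λ G : Type*} [Group Λ] [Group G] {E : Finset Δ} (hE : 1 ∈ E)
    {S : Finset A} {π : A → Δ → Λ} (hπ : ∀ s ∈ S, IsInjPartialHomOn E (π s)) {ψ : Λ → G}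
    (hψ : IsUnital ψ) : coordinates S π ψ 1 = 1 := by
  funext a
  by_cases ha : a ∈ S
  · rw [coordinates_of_mem ha, (hπ a ha).map_one hE, Pi.one_apply]
    exact hψ
  · exact if_neg ha

theorem expect_dist_coordinates_mul_le {A Λ G : Type*} [Fintype A] [Nonempty A] [DecidableEq Λ]
    [Group Λ] [Group G] {d : G → G → ℝ} {K η : ℝ} (hK : 0 ≤ K) (hdK : ∀ g h, d g h ≤ K)
    (hη : 0 ≤ η) {E : Finset Δ} {S : Finset A} {π : A → Δ → Λ} {ψ : Λ → G}
    (hS : (1 - η) * Fintype.card A ≤ S.card) (hπ : ∀ s ∈ S, IsInjPartialHomOn E (π s))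
    (hψ : IsMultiplicativeOn d (S.biUnion fun s => E.image (π s)) η ψ) {e f f' : Δ} (he : e ∈ E)
    (hf : f ∈ E) (hef : e * f ∈ E) (σ : Equiv.Perm A)
    (hσ : ∀ s ∈ S, σ s ∈ S → π (σ s) f = π s f') :
    𝔼 a, d (coordinates S π ψ (e * f) a)
      (coordinates S π ψ e a * coordinates S π ψ f' (σ⁻¹ a)) ≤ η + 2 * η * K := by
  refine expect_le_of_forall_map_mem_le σ hη hK hS (fun s hs hσs => ?_) fun a => hdK _ _
  have hπE {e} (he : e ∈ E) : π (σ s) e ∈ S.biUnion fun s => E.image (π s) :=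
    Finset.mem_biUnion.2 ⟨σ s, hσs, Finset.mem_image_of_mem _ he⟩
  have π_mul : π (σ s) (e * f) = π (σ s) e * π (σ s) f := (hπ _ hσs).2 e he f hf hef
  have ψ_mul := hψ _ (hπE he) _ (hπE hf) (π_mul ▸ hπE hef)
  rw [coordinates_of_mem hσs, coordinates_of_mem hσs, Equiv.Perm.coe_inv, σ.symm_apply_apply,
    coordinates_of_mem hs, ← hσ s hs hσs, π_mul]
  exact ψ_mul.le

variable {𝒢 : MetricFamily.{u, v}}

theorem half_lt_expect_len_coordinates {A Λ : Type*} [Fintype A] [DecidableEq Λ] [Group Λ]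
    {i : 𝒢.Idx} {c : ℝ} (hc : 0 ≤ c) {E : Finset Δ} {S : Finset A} {π : A → Δ → Λ} {ψ : Λ → 𝒢.G i}
    (hS : (Fintype.card A : ℝ) / 2 < S.card) (hE : 1 ∈ E)
    (hπ : ∀ s ∈ S, IsInjPartialHomOn E (π s))
    (hψ : IsSeparatingOn (𝒢.dist i) (S.biUnion fun s => E.image (π s)) c ψ) {e : Δ} (he : e ∈ E)
    (he1 : e ≠ 1) : c / 2 < 𝔼 a, 𝒢.len i (coordinates S π ψ e a) := by
  refine half_lt_expect hc hS (fun s hs => ?_) fun _ => MetricFamily.len_nonneg _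
  rw [coordinates_of_mem hs]
  exact hψ _ (Finset.mem_biUnion.2 ⟨s, hs, Finset.mem_image_of_mem _ he⟩)
    ((hπ s hs).map_ne_one hE he he1)

theorem IsSoficAction.isApproximableAlong_ker (h𝒢 : 𝒢.IsWreathClosed) {c : ℝ} (hc : 0 ≤ c)
    {β : Γ →* MulAut Δ} (hβ : IsSoficAction (fun Λ [Group Λ] => 𝒢.IsApproximableWith c Λ) β) :
    𝒢.IsApproximableAlong (c / 2) (SemidirectProduct.rightHom (φ := β)).ker := by
  classical
  intro F ε hε
  obtain ⟨D, hD⟩ := 𝒢.bounded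
  obtain ⟨η, hη, hη2, hηε⟩ := exists_tolerance hε (max D 0)
  obtain ⟨E, hE1, hE, hEβ⟩ := exists_finset_left_mem β F
  obtain ⟨Λ, _, A, _, _, φ, hΛ, φ_one, φ_mul, S, π, hS, hπ, π_equivariant⟩ :=
    hβ (F.image (·.right)) E η hη
  have hFr {g} (hg : g ∈ F) : g.right ∈ F.image (·.right) := Finset.mem_image_of_mem _ hg
  have : Nonempty A := by
    by_contra! hA
    simp [Finset.eq_empty_of_isEmpty S] at hS
  obtain ⟨i, ψ, ψ_mul, ψ_sep, ψ_one⟩ := hΛ (S.biUnion fun s => E.image (π s)) η hη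
  obtain ⟨j, ⟨W⟩⟩ := h𝒢.exists_wreathRep i A
  refine ⟨j, fun g => W.hom ⟨coordinates S π ψ g.left, φ g.right⟩,
    fun g hg h hh hgh => ?_, fun g hg hg_ker hg1 => ?_, ?_⟩
  · rw [← map_mul]
    refine (MetricFamily.dist_wreathRep_le W _ _).trans_lt (lt_of_le_of_lt ?_ hηε)
    refine add_le_add (Real.sqrt_le_sqrt ?_) (Real.sqrt_le_sqrt ?_)
    · refine mul_le_mul_of_nonneg_left ?_ zero_le_two
      refine expect_dist_coordinates_mul_le (le_max_right D 0)
        (fun x y => (hD i x y).trans (le_max_left D 0)) hη.le hS.le hπ ψ_mul (hE g hg)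
        (hEβ g hg h hh) (hE _ hgh) (φ g.right) fun s hs hφs => ?_
      have := π_equivariant g.right (hFr hg) (β g.right h.left) (hEβ g hg h hh) s hs hφs
      rw [MulAut.inv_apply_self] at this
      exact this (hE h hh)
    · refine mul_le_mul_of_nonneg_left ?_ zero_le_two
      exact (φ_mul g.right (hFr hg) h.right (hFr hh) (hFr hgh)).le
  · have hg_right : g.right = 1 := MonoidHom.mem_ker.1 hg_ker
    have hg_left : g.left ≠ 1 := fun hl => hg1 (SemidirectProduct.ext hl hg_right)
    dsimp only
    rw [hg_right, show φ 1 = 1 from φ_one]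
    refine (half_lt_expect_len_coordinates hc ?_ hE1 hπ ψ_sep (hE g hg) hg_left).trans_le
      (W.expect_le _)
    nlinarith
  · rw [IsUnital, SemidirectProduct.one_left, SemidirectProduct.one_right,
      coordinates_one hE1 hπ ψ_one, show φ 1 = 1 from φ_one]
    exact map_one W.hom

theorem MetricFamily.IsApproximable.semidirectProduct {β : Γ →* MulAut Δ}
    (hΓ : 𝒢.IsApproximable Γ) (h𝒢 : 𝒢.IsWreathClosed)
    (hβ : IsSoficAction (fun Λ [Group Λ] => 𝒢.IsApproximable Λ) β) :
    𝒢.IsApproximable (Δ ⋊[β] Γ) := by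
  have hβ_ker : 𝒢.IsApproximableAlong (1 / 16 / 2) (SemidirectProduct.rightHom (φ := β)).ker :=
    (hβ.mono fun _ _ hΛ => hΛ.isApproximableWith h𝒢).isApproximableAlong_ker h𝒢 (by norm_num)
  have hΓ_with : 𝒢.IsApproximableWith (1 / 16 / 2) Γ :=
    (hΓ.isApproximableWith h𝒢).mono (by norm_num)
  exact ⟨_, by norm_num, hβ_ker.isApproximableWith h𝒢 hΓ_with⟩

end SemidirectProduct

section Sofic

variable {ι κ : Type*} [Fintype ι] [DecidableEq ι] [Nonempty ι] [Fintype κ] [DecidableEq κ]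
  [Nonempty κ] {A : Type*} [Fintype A] [DecidableEq A] [Nonempty A]

theorem hammingMetric_one_eq_one_sub (σ : Equiv.Perm ι) :
    hammingMetric σ 1 = 1 - 𝔼 x, if σ x = x then 1 else 0 := by
  have card_fixed_add_card_moved := Finset.card_filter_add_card_filter_not
    (s := Finset.univ) (fun x => σ x = x)
  rw [Finset.card_univ] at card_fixed_add_card_moved
  rw [Fintype.expect_eq_sum_div_card, Finset.sum_boole, hammingMetric, hammingDist,
    eq_sub_iff_add_eq, ← add_div, div_eq_one_iff_eq (by positivity), ← card_fixed_add_card_moved]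
  push_cast
  exact add_comm _ _

theorem hammingMetric_prodCongrRight (f : A → Equiv.Perm ι) :
    hammingMetric (Equiv.prodCongrRight f) 1 = 𝔼 a, hammingMetric (f a) 1 := by
  simp only [hammingMetric_one_eq_one_sub, Finset.expect_sub_distrib, Fintype.expect_const]
  rw [← Finset.univ_product_univ, Finset.expect_product]
  simp

theorem hammingMetric_prodCongr (σ : Equiv.Perm ι) (τ : Equiv.Perm κ) :
    hammingMetric (σ.prodCongr τ) 1 = 1 - (1 - hammingMetric σ 1) * (1 - hammingMetric τ 1) := by
  simp only [hammingMetric_one_eq_one_sub, sub_sub_cancel]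
  rw [Finset.expect_mul_expect, ← Finset.univ_product_univ, Finset.expect_product]
  simp only [Equiv.prodCongr_apply, Prod.map_apply, Prod.mk.injEq, ite_zero_mul_ite_zero, mul_one]

theorem sq_hammingMetric_le (σ τ : Equiv.Perm ι) :
    hammingMetric σ τ ^ 2 ≤ 2 * hammingMetric σ τ := by
  have := isBiinvariantMetric_hammingMetric.nonneg σ τ
  nlinarith [hammingMetric_le_one σ τ]

/-- The imprimitive action of `Sym(ι) ≀ Sym(A)` on `A × ι`. -/
def imprimitiveHom : PermWreath A (Equiv.Perm ι) →* Equiv.Perm (A × ι) :=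
  SemidirectProduct.lift
    { toFun := Equiv.prodCongrRight, map_one' := rfl, map_mul' := fun _ _ => rfl }
    { toFun := fun σ => σ.prodCongr 1, map_one' := rfl, map_mul' := fun _ _ => rfl }
    fun σ => by
      ext f ⟨a, i⟩
      · exact (σ.apply_symm_apply a).symm
      · rfl

/-- Permutational wreath products of symmetric groups, represented by their imprimitive action. -/
def permWreathRep : WreathRep (fun σ : Equiv.Perm ι => hammingMetric σ 1) A
    (fun σ : Equiv.Perm (A × ι) => hammingMetric σ 1) where
  hom := imprimitiveHom
  expect_le f := by
    rw [imprimitiveHom, SemidirectProduct.lift_inl]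
    exact (hammingMetric_prodCongrRight f).ge
  sq_inl_le f := by
    rw [imprimitiveHom, SemidirectProduct.lift_inl, ← hammingMetric_prodCongrRight]
    exact sq_hammingMetric_le _ _
  sq_inr_le σ := by
    have length_eq : hammingMetric (imprimitiveHom (ι := ι) (.inr σ)) 1 = hammingMetric σ 1 := by
      rw [imprimitiveHom, SemidirectProduct.lift_inr]
      refine (hammingMetric_prodCongr σ 1).trans ?_
      rw [isBiinvariantMetric_hammingMetric.self]
      ring
    rw [length_eq]
    exact sq_hammingMetric_le _ _

/-- Products of symmetric groups, represented by their product action. -/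
def permProductRep : ProductRep (fun σ : Equiv.Perm ι => hammingMetric σ 1)
    (fun σ : Equiv.Perm κ => hammingMetric σ 1)
    (fun σ : Equiv.Perm (ι × κ) => hammingMetric σ 1) where
  hom :=
    { toFun := fun x => x.1.prodCongr x.2, map_one' := rfl, map_mul' := fun _ _ => rfl }
  length_left σ := by
    refine (hammingMetric_prodCongr σ 1).trans ?_
    rw [isBiinvariantMetric_hammingMetric.self]
    ring
  length_right σ := by
    refine (hammingMetric_prodCongr 1 σ).trans ?_
    rw [isBiinvariantMetric_hammingMetric.self]
    ring

theorem soficFamily_represents (ι : Type) [Fintype ι] [DecidableEq ι] [Nontrivial ι] :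
    soficFamily.Represents fun σ : Equiv.Perm ι => hammingMetric σ 1 := by
  have : Nontrivial (Fin (Fintype.card ι)) := (Fintype.equivFin ι).symm.nontrivial
  refine ⟨⟨Fintype.card ι, inferInstance⟩, (Fintype.equivFin ι).permCongrHom.toMonoidHom,
    fun σ => ?_⟩
  change hammingMetric ((Fintype.equivFin ι).permCongr σ) 1 = hammingMetric σ 1
  rw [hammingMetric_one_eq_one_sub, hammingMetric_one_eq_one_sub,
    ← Fintype.expect_equiv (Fintype.equivFin ι) _ _ fun _ => rfl]
  simp [Equiv.permCongr_apply]

theorem nontrivial_of_nontrivial_perm {α : Type*} [Nontrivial (Equiv.Perm α)] : Nontrivial α := by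
  by_contra hα
  rw [not_nontrivial_iff_subsingleton] at hα
  exact not_subsingleton (Equiv.Perm α) inferInstance

theorem soficFamily_isWreathClosed : soficFamily.IsWreathClosed where
  exists_wreathRep := by
    rintro ⟨n, hn⟩ A _ _ _
    have := nontrivial_of_nontrivial_perm (α := Fin n)
    obtain ⟨k, e, he⟩ := soficFamily_represents (A × Fin n)
    exact ⟨k, ⟨permWreathRep.mapIsometry e he⟩⟩
  exists_productRep := by
    rintro ⟨n, hn⟩ ⟨n', hn'⟩
    have := nontrivial_of_nontrivial_perm (α := Fin n)
    have := nontrivial_of_nontrivial_perm (α := Fin n')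
    obtain ⟨k, e, he⟩ := soficFamily_represents (Fin n × Fin n')
    exact ⟨k, ⟨permProductRep.mapIsometry e he⟩⟩
  exists_expanding_productRep := by
    rintro ⟨n, hn⟩
    have := nontrivial_of_nontrivial_perm (α := Fin n)
    obtain ⟨k, e, he⟩ := soficFamily_represents (Fin n × Fin n)
    refine ⟨k, permProductRep.mapIsometry e he, fun (σ : Equiv.Perm (Fin n)) hσ => ?_⟩
    refine le_trans ?_ (he (σ.prodCongr σ)).ge
    change hammingMetric σ 1 ≤ 1 / 6 at hσ
    change 5 / 4 * hammingMetric σ 1 ≤ hammingMetric (σ.prodCongr σ) 1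
    have := isBiinvariantMetric_hammingMetric.nonneg σ 1
    rw [hammingMetric_prodCongr]
    nlinarith

end Sofic

section WeaklySofic

section Product

variable {G : Type*} [Group G] {d : G → G → ℝ} {G' : Type*} [Group G'] {d' : G' → G' → ℝ}

/-- The sum of the metrics of two groups on their product, truncated at one. -/
def truncatedSumMetric (d : G → G → ℝ) (d' : G' → G' → ℝ) (x y : G × G') : ℝ :=
  min 1 (d x.1 y.1 + d' x.2 y.2)

theorem IsBiinvariantMetric.truncatedSumMetric (hd : IsBiinvariantMetric d)
    (hd' : IsBiinvariantMetric d') : IsBiinvariantMetric (truncatedSumMetric d d') where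
  self x := by simp [MetricApprox.truncatedSumMetric, hd.self, hd'.self]
  eq_of_dist_eq_zero {x y} dist_eq_zero := by
    have nonneg_left := hd.nonneg x.1 y.1
    have nonneg_right := hd'.nonneg x.2 y.2
    have sum_le : d x.1 y.1 + d' x.2 y.2 ≤ 0 :=
      (min_le_iff.1 dist_eq_zero.le).resolve_left (by norm_num)
    exact Prod.ext (hd.eq_of_dist_eq_zero (by linarith)) (hd'.eq_of_dist_eq_zero (by linarith))
  symm x y := by simp only [MetricApprox.truncatedSumMetric, hd.symm x.1, hd'.symm x.2]
  triangle x y z := by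
    have triangle_left := hd.triangle x.1 y.1 z.1
    have triangle_right := hd'.triangle x.2 y.2 z.2
    have := hd.nonneg x.1 y.1
    have := hd.nonneg y.1 z.1
    have := hd'.nonneg x.2 y.2
    have := hd'.nonneg y.2 z.2
    unfold MetricApprox.truncatedSumMetric
    rw [min_add, add_min, add_min]
    refine le_min (le_min ?_ ?_) (le_min ?_ ?_) <;> rw [min_le_iff]
    exacts [.inl (by linarith), .inl (by linarith), .inl (by linarith), .inr (by linarith)]
  mul_left a x y := by
    simp only [MetricApprox.truncatedSumMetric, Prod.fst_mul, Prod.snd_mul, hd.mul_left,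
      hd'.mul_left]
  mul_right a x y := by
    simp only [MetricApprox.truncatedSumMetric, Prod.fst_mul, Prod.snd_mul, hd.mul_right,
      hd'.mul_right]

/-- The product of two groups with metrics of diameter at most one, represented by itself. -/
def truncatedSumProductRep (hd : IsBiinvariantMetric d) (hd_le : ∀ g h, d g h ≤ 1)
    (hd' : IsBiinvariantMetric d') (hd'_le : ∀ g h, d' g h ≤ 1) :
    ProductRep (fun g => d g 1) (fun g => d' g 1) (fun x => truncatedSumMetric d d' x 1) where
  hom := MonoidHom.id _
  length_left x := by simp [truncatedSumMetric, hd'.self, hd_le]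
  length_right y := by simp [truncatedSumMetric, hd.self, hd'_le]

end Product

section Wreath

variable {G : Type*} [Group G] {A : Type*} [Fintype A] [DecidableEq A] {d : G → G → ℝ}

/-- The metric on the permutational wreath product of `G` by `Sym(A)` which averages, over the
points of `A`, the distance of the values where the inverse permutations agree, and one elsewhere.
The inverses appear because the group of functions acts on the left. -/
noncomputable def wreathMetric (d : G → G → ℝ) (x y : PermWreath A G) : ℝ :=
  𝔼 a, if x.right⁻¹ a = y.right⁻¹ a then d (x.left a) (y.left a) else 1

theorem eq_of_wreathMetric_eq_zero (hd : IsBiinvariantMetric d) {x y : PermWreath A G}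
    (hxy : wreathMetric d x y = 0) : x = y := by
  have summand_nonneg (a : A) :
      0 ≤ if x.right⁻¹ a = y.right⁻¹ a then d (x.left a) (y.left a) else 1 := by
    split_ifs
    exacts [hd.nonneg _ _, zero_le_one]
  have summand_eq_zero (a : A) :
      (if x.right⁻¹ a = y.right⁻¹ a then d (x.left a) (y.left a) else 1) = 0 :=
    (Finset.expect_eq_zero_iff_of_nonneg fun a _ => summand_nonneg a).1 hxy a
      (Finset.mem_univ a)
  have right_inv_apply (a : A) : x.right⁻¹ a = y.right⁻¹ a := by
    by_contra hne
    exact one_ne_zero ((if_neg hne).symm.trans (summand_eq_zero a))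
  exact SemidirectProduct.ext
    (funext fun a => hd.eq_of_dist_eq_zero <|
      (if_pos (right_inv_apply a)).symm.trans (summand_eq_zero a))
    (inv_injective (Equiv.ext right_inv_apply))

theorem wreathMetric_triangle (hd : IsBiinvariantMetric d) (hd_le : ∀ g h, d g h ≤ 1)
    (x y z : PermWreath A G) : wreathMetric d x z ≤ wreathMetric d x y + wreathMetric d y z := by
  unfold wreathMetric
  rw [← Finset.expect_add_distrib]
  refine Finset.expect_le_expect fun a _ => ?_
  have := hd.triangle (x.left a) (y.left a) (z.left a)
  have := hd.nonneg (x.left a) (y.left a)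
  have := hd.nonneg (y.left a) (z.left a)
  have := hd_le (x.left a) (z.left a)
  split_ifs with hxz hxy hyz hyz hxy hyz hyz
  all_goals first | linarith | (exfalso; simp_all)

theorem wreathMetric_mul_left (hd : IsBiinvariantMetric d) (c x y : PermWreath A G) :
    wreathMetric d (c * x) (c * y) = wreathMetric d x y := by
  refine (Fintype.expect_equiv c.right _ _ fun a => ?_).symm
  have shift (f : A → G) : mulAutArrow c.right f (c.right a) = f a :=
    congrArg f (c.right.symm_apply_apply a)
  simp only [SemidirectProduct.mul_left, SemidirectProduct.mul_right, mul_inv_rev,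
    Equiv.Perm.mul_apply, Pi.mul_apply, hd.mul_left, shift, Equiv.Perm.coe_inv,
    c.right.symm_apply_apply]

theorem wreathMetric_mul_right (hd : IsBiinvariantMetric d) (c x y : PermWreath A G) :
    wreathMetric d (x * c) (y * c) = wreathMetric d x y := by
  refine Finset.expect_congr rfl fun a _ => ?_
  have shift (σ : Equiv.Perm A) : mulAutArrow σ c.left a = c.left (σ⁻¹ a) := rfl
  simp only [SemidirectProduct.mul_left, SemidirectProduct.mul_right, mul_inv_rev,
    Equiv.Perm.mul_apply, Pi.mul_apply, shift, EmbeddingLike.apply_eq_iff_eq]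
  refine ite_congr rfl (fun h => ?_) fun _ => rfl
  rw [h, hd.mul_right]

theorem IsBiinvariantMetric.wreathMetric (hd : IsBiinvariantMetric d)
    (hd_le : ∀ g h, d g h ≤ 1) : IsBiinvariantMetric (wreathMetric (A := A) d) where
  self x := by simp [MetricApprox.wreathMetric, hd.self]
  eq_of_dist_eq_zero := eq_of_wreathMetric_eq_zero hd
  symm x y := by simp only [MetricApprox.wreathMetric, hd.symm, eq_comm]
  triangle := wreathMetric_triangle hd hd_le
  mul_left := wreathMetric_mul_left hd
  mul_right := wreathMetric_mul_right hd

theorem wreathMetric_le_one [Nonempty A] (hd_le : ∀ g h, d g h ≤ 1) (x y : PermWreath A G) :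
    wreathMetric d x y ≤ 1 := by
  refine Finset.expect_le Finset.univ_nonempty fun a _ => ?_
  split_ifs
  exacts [hd_le _ _, le_rfl]

theorem wreathMetric_inl_inl (f g : A → G) :
    wreathMetric d (SemidirectProduct.inl f : PermWreath A G) (.inl g) = 𝔼 a, d (f a) (g a) := by
  simp [wreathMetric]

theorem wreathMetric_inl_one (f : A → G) :
    wreathMetric d (SemidirectProduct.inl f : PermWreath A G) 1 = 𝔼 a, d (f a) 1 :=
  wreathMetric_inl_inl f 1

theorem wreathMetric_inr_one [Nonempty A] (hd : IsBiinvariantMetric d) (σ : Equiv.Perm A) :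
    wreathMetric d (SemidirectProduct.inr σ : PermWreath A G) 1 = hammingMetric σ 1 := by
  have inv_apply_eq (a : A) : σ⁻¹ a = a ↔ σ a = a := by rw [Equiv.Perm.inv_eq_iff_eq, eq_comm]
  have summand_eq (a : A) :
      (if σ⁻¹ a = a then (0 : ℝ) else 1) = 1 - if σ a = a then 1 else 0 := by
    simp only [inv_apply_eq]
    split_ifs <;> simp
  calc wreathMetric d (SemidirectProduct.inr σ : PermWreath A G) 1
      = 𝔼 a, if σ⁻¹ a = a then 0 else 1 := by simp [wreathMetric, hd.self]
    _ = hammingMetric σ 1 := by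
      simp only [summand_eq, Finset.expect_sub_distrib, Fintype.expect_const,
        hammingMetric_one_eq_one_sub]

/-- The permutational wreath product with the metric `wreathMetric`, represented by itself. -/
noncomputable def wreathMetricRep [Nonempty A] (hd : IsBiinvariantMetric d)
    (hd_le : ∀ g h, d g h ≤ 1) :
    WreathRep (fun g => d g 1) A (fun x : PermWreath A G => wreathMetric d x 1) :=
  have sq_le (x : PermWreath A G) : wreathMetric d x 1 ^ 2 ≤ 2 * wreathMetric d x 1 := by
    have := (hd.wreathMetric hd_le).nonneg x 1
    nlinarith [wreathMetric_le_one hd_le x 1]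
  { hom := MonoidHom.id _
    expect_le := fun f => (wreathMetric_inl_one f).ge
    sq_inl_le := fun f => (sq_le _).trans_eq (congrArg (2 * ·) (wreathMetric_inl_one f))
    sq_inr_le := fun σ => (sq_le _).trans_eq (congrArg (2 * ·) (wreathMetric_inr_one hd σ)) }

end Wreath

theorem weaklySoficFamily_represents {H : Type} [Group H] [Finite H] {d : H → H → ℝ}
    (hd : IsBiinvariantMetric d) (hd_le : ∀ g h, d g h ≤ 1) (hd_eq : ∃ g h, d g h = 1) :
    weaklySoficFamily.Represents fun x => d x 1 :=
  ⟨⟨H, d, hd, hd_le, hd_eq⟩, MonoidHom.id H, fun _ => rfl⟩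

theorem weaklySoficFamily_isWreathClosed : weaklySoficFamily.IsWreathClosed where
  exists_wreathRep := by
    rintro ⟨G, d, hd, hd_le, g, h, hgh⟩ A _ _ _
    have : Finite (PermWreath A G) := Finite.of_equiv _ SemidirectProduct.equivProd.symm
    obtain ⟨k, e, he⟩ := weaklySoficFamily_represents (hd.wreathMetric (A := A) hd_le)
      (wreathMetric_le_one hd_le)
      ⟨.inl fun _ => g, .inl fun _ => h, by rw [wreathMetric_inl_inl]; simp [hgh]⟩
    exact ⟨k, ⟨(wreathMetricRep hd hd_le).mapIsometry e he⟩⟩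
  exists_productRep := by
    rintro ⟨G, d, hd, hd_le, g, h, hgh⟩ ⟨G', d', hd', hd'_le, -⟩
    obtain ⟨k, e, he⟩ := weaklySoficFamily_represents (hd.truncatedSumMetric hd')
      (fun _ _ => min_le_left _ _)
      ⟨(g, 1), (h, 1), by simp [truncatedSumMetric, hgh, hd'.self]⟩
    exact ⟨k, ⟨(truncatedSumProductRep hd hd_le hd' hd'_le).mapIsometry e he⟩⟩
  exists_expanding_productRep := by
    rintro ⟨G, d, hd, hd_le, g, h, hgh⟩
    obtain ⟨k, e, he⟩ := weaklySoficFamily_represents (hd.truncatedSumMetric hd)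
      (fun _ _ => min_le_left _ _)
      ⟨(g, 1), (h, 1), by simp [truncatedSumMetric, hgh, hd.self]⟩
    refine ⟨k, (truncatedSumProductRep hd hd_le hd hd_le).mapIsometry e he,
      fun x hx => le_trans ?_ (he (x, x)).ge⟩
    change d x 1 ≤ 1 / 6 at hx
    change 5 / 4 * d x 1 ≤ min 1 (d x 1 + d x 1)
    have := hd.nonneg x 1
    exact le_min (by linarith) (by linarith)

end WeaklySofic

section MatrixRepresentations

section Kronecker

variable {ι κ R : Type*} [DecidableEq ι] [DecidableEq κ] [CommRing R]

theorem kronecker_one_sub_one (M : Matrix ι ι R) :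
    M ⊗ₖ (1 : Matrix κ κ R) - 1 = (M - 1) ⊗ₖ 1 := by
  rw [sub_eq_iff_eq_add, ← Matrix.one_kronecker_one, ← Matrix.add_kronecker, sub_add_cancel]

theorem one_kronecker_sub_one (M : Matrix ι ι R) :
    (1 : Matrix κ κ R) ⊗ₖ M - 1 = 1 ⊗ₖ (M - 1) := by
  rw [sub_eq_iff_eq_add, ← Matrix.one_kronecker_one, ← Matrix.kronecker_add, sub_add_cancel]

end Kronecker

variable {ι κ A R : Type*} [Fintype ι] [DecidableEq ι] [Fintype κ] [DecidableEq κ] [Fintype A]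
  [DecidableEq A] [CommRing R]

/-- The Kronecker product of square matrices as a monoid homomorphism. -/
def kroneckerHom : Matrix ι ι R × Matrix κ κ R →* Matrix (ι × κ) (ι × κ) R where
  toFun x := x.1 ⊗ₖ x.2
  map_one' := Matrix.one_kronecker_one
  map_mul' _ _ := Matrix.mul_kronecker_mul _ _ _ _

theorem one_kronecker_permMatrixHom_mul_blockDiagonal (σ : Equiv.Perm A) (f : A → Matrix ι ι R) :
    ((1 : Matrix ι ι R) ⊗ₖ Matrix.permMatrixHom σ) * Matrix.blockDiagonal f =
      Matrix.blockDiagonal (fun a => f (σ⁻¹ a)) *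
        ((1 : Matrix ι ι R) ⊗ₖ Matrix.permMatrixHom σ) := by
  ext ⟨x, a⟩ ⟨y, b⟩
  have entry (i j : A) : Matrix.permMatrixHom σ i j = if σ⁻¹ i = j then (1 : R) else 0 := by
    simp
  simp only [Matrix.mul_apply, Fintype.sum_prod_type, Matrix.kronecker_apply, Matrix.one_apply,
    Matrix.blockDiagonal_apply, entry, mul_ite, ite_mul, mul_one, one_mul, mul_zero, zero_mul]
  trans if σ⁻¹ a = b then f (σ⁻¹ a) x y else 0
  · rw [Finset.sum_eq_single x (by simp +contextual [eq_comm]) (by simp)]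
    by_cases moved : σ.symm a = b <;> simp [moved]
  · rw [Finset.sum_eq_single y (by simp +contextual) (by simp),
      Finset.sum_eq_single a (by simp +contextual [eq_comm]) (by simp)]
    simp

/-- The representation of a permutational wreath product on `ι × A` by monomial block matrices
induced from a representation `ρ` on `ι`. -/
def inducedHom {G : Type*} [Group G] (ρ : G →* Matrix ι ι R) :
    PermWreath A G →* Matrix (ι × A) (ι × A) R where
  toFun x := Matrix.blockDiagonal (fun a => ρ (x.left a)) * (1 ⊗ₖ Matrix.permMatrixHom x.right)
  map_one' := by
    simp only [SemidirectProduct.one_left, SemidirectProduct.one_right, Pi.one_apply, map_one,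
      Matrix.one_kronecker_one, mul_one]
    exact Matrix.blockDiagonal_one
  map_mul' x y := by
    have blockDiagonal_mul_left : Matrix.blockDiagonal (fun a => ρ ((x * y).left a)) =
        Matrix.blockDiagonal (fun a => ρ (x.left a)) *
          Matrix.blockDiagonal fun a => ρ (y.left (x.right⁻¹ a)) := by
      rw [← Matrix.blockDiagonal_mul]
      exact congrArg _ (funext fun a => map_mul ρ _ _)
    have permMatrix_mul : (1 : Matrix ι ι R) ⊗ₖ Matrix.permMatrixHom (x * y).right =
        ((1 : Matrix ι ι R) ⊗ₖ Matrix.permMatrixHom x.right) *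
          ((1 : Matrix ι ι R) ⊗ₖ Matrix.permMatrixHom y.right) := by
      rw [← Matrix.mul_kronecker_mul, one_mul, ← map_mul, SemidirectProduct.mul_right]
    rw [blockDiagonal_mul_left, permMatrix_mul, mul_assoc, mul_assoc,
      ← mul_assoc (Matrix.blockDiagonal _) (1 ⊗ₖ _),
      ← one_kronecker_permMatrixHom_mul_blockDiagonal x.right fun a => ρ (y.left a), mul_assoc]

theorem inducedHom_inl {G : Type*} [Group G] (ρ : G →* Matrix ι ι R) (f : A → G) :
    inducedHom ρ (.inl f) = Matrix.blockDiagonal fun a => ρ (f a) := by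
  simp [inducedHom]

theorem inducedHom_inr {G : Type*} [Group G] (ρ : G →* Matrix ι ι R) (σ : Equiv.Perm A) :
    inducedHom ρ (.inr σ) = 1 ⊗ₖ Matrix.permMatrixHom σ := by
  simp only [inducedHom, MonoidHom.coe_mk, OneHom.coe_mk, SemidirectProduct.left_inr,
    SemidirectProduct.right_inr, Pi.one_apply, map_one]
  exact (congrArg (· * _) Matrix.blockDiagonal_one).trans (one_mul _)

end MatrixRepresentations

section Rank

variable {K : Type*} [Field K]

theorem exists_eq_mul_diagonal_mul {ι : Type*} [Fintype ι] [DecidableEq ι] (M : Matrix ι ι K) :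
    ∃ (V U : Matrix ι ι K) (w : ι → K), IsUnit V.det ∧ IsUnit U.det ∧
      M = V * Matrix.diagonal w * U := by
  obtain ⟨L, L', w, hM⟩ := Matrix.Pivot.exists_list_transvec_mul_diagonal_mul_list_transvec M
  exact ⟨_, _, w, by simp, by simp, hM⟩

theorem rank_mul_diagonal_mul {ι : Type*} [Fintype ι] [DecidableEq ι] [DecidableEq K]
    {V U : Matrix ι ι K} (hV : IsUnit V.det) (hU : IsUnit U.det) (w : ι → K) :
    (V * Matrix.diagonal w * U).rank = Fintype.card {i // w i ≠ 0} := by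
  rw [Matrix.rank_mul_eq_left_of_isUnit_det _ _ hU, Matrix.rank_mul_eq_right_of_isUnit_det _ _ hV,
    Matrix.rank_diagonal]

theorem rank_kronecker {ι κ : Type*} [Fintype ι] [Fintype κ] (M : Matrix ι ι K)
    (N : Matrix κ κ K) : (M ⊗ₖ N).rank = M.rank * N.rank := by
  classical
  obtain ⟨V, U, w, hV, hU, rfl⟩ := exists_eq_mul_diagonal_mul M
  obtain ⟨V', U', w', hV', hU', rfl⟩ := exists_eq_mul_diagonal_mul N
  have isUnit_det {X : Matrix ι ι K} {Y : Matrix κ κ K} (hX : IsUnit X.det) (hY : IsUnit Y.det) :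
      IsUnit (X ⊗ₖ Y).det := by
    rw [Matrix.det_kronecker]
    exact (hX.pow _).mul (hY.pow _)
  rw [Matrix.mul_kronecker_mul, Matrix.mul_kronecker_mul, Matrix.diagonal_kronecker_diagonal,
    rank_mul_diagonal_mul (isUnit_det hV hV') (isUnit_det hU hU'),
    rank_mul_diagonal_mul hV hU, rank_mul_diagonal_mul hV' hU', ← Fintype.card_prod]
  exact Fintype.card_congr ((Equiv.subtypeEquivRight fun x => mul_ne_zero_iff).trans
    (Equiv.subtypeProdEquivProd (p := fun i => w i ≠ 0) (q := fun i => w' i ≠ 0)))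

theorem rank_blockDiagonal {ι A : Type*} [Fintype ι] [Fintype A] [DecidableEq A]
    (M : A → Matrix ι ι K) : (Matrix.blockDiagonal M).rank = ∑ a, (M a).rank := by
  classical
  choose V U w hV hU hM using fun a => exists_eq_mul_diagonal_mul (M a)
  have isUnit_det {X : A → Matrix ι ι K} (hX : ∀ a, IsUnit (X a).det) :
      IsUnit (Matrix.blockDiagonal X).det := by
    rw [Matrix.det_blockDiagonal, isUnit_iff_ne_zero, Finset.prod_ne_zero_iff]
    exact fun a _ => (hX a).ne_zero
  obtain rfl : M = V * (fun a => Matrix.diagonal (w a)) * U := funext hM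
  have blockDiagonal_eq : Matrix.blockDiagonal (V * (fun a => Matrix.diagonal (w a)) * U) =
      Matrix.blockDiagonal V * Matrix.diagonal (fun x : ι × A => w x.2 x.1) *
        Matrix.blockDiagonal U := by
    rw [← Matrix.blockDiagonal_diagonal, ← Matrix.blockDiagonal_mul, ← Matrix.blockDiagonal_mul]
    rfl
  rw [blockDiagonal_eq, rank_mul_diagonal_mul (isUnit_det hV) (isUnit_det hU)]
  simp only [Pi.mul_apply, rank_mul_diagonal_mul (hV _) (hU _), ← Fintype.card_sigma]
  exact Fintype.card_congr
    { toFun := fun x => ⟨x.1.2, x.1.1, x.2⟩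
      invFun := fun x => ⟨(x.2.1, x.1), x.2.2⟩
      left_inv := fun _ => rfl
      right_inv := fun _ => rfl }

theorem finrank_map_add_finrank_inf_ker {V W : Type*} [AddCommGroup V] [Module K V]
    [AddCommGroup W] [Module K W] [FiniteDimensional K V] (T : V →ₗ[K] W) (S : Submodule K V) :
    Module.finrank K (S.map T) + Module.finrank K (S ⊓ LinearMap.ker T : Submodule K V) =
      Module.finrank K S := by
  rw [← LinearMap.finrank_range_add_finrank_ker (T.domRestrict S), LinearMap.range_domRestrict,
    LinearMap.ker_domRestrict, ← Submodule.map_comap_subtype]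
  congr 1
  exact LinearEquiv.finrank_eq
    (Submodule.equivMapOfInjective S.subtype S.injective_subtype _).symm

theorem rank_mul_add_rank_mul_le {l m n p : Type*} [Fintype m] [Fintype n] [Fintype p]
    (T : Matrix l m K) (L : Matrix m n K) (C : Matrix n p K) :
    (T * L).rank + (L * C).rank ≤ L.rank + (T * L * C).rank := by
  have range_le : LinearMap.range (L * C).mulVecLin ≤ LinearMap.range L.mulVecLin := by
    rw [Matrix.mulVecLin_mul]
    exact LinearMap.range_comp_le_range _ _
  have finrank_L := finrank_map_add_finrank_inf_ker T.mulVecLin (LinearMap.range L.mulVecLin)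
  have finrank_LC :=
    finrank_map_add_finrank_inf_ker T.mulVecLin (LinearMap.range (L * C).mulVecLin)
  have finrank_inf_ker_le :=
    Submodule.finrank_mono (inf_le_inf_right (LinearMap.ker T.mulVecLin) range_le)
  rw [← LinearMap.range_comp, ← Matrix.mulVecLin_mul] at finrank_L finrank_LC
  rw [Matrix.mul_assoc]
  unfold Matrix.rank
  omega

theorem exists_mul_eq_zero_and_rank_add_rank_eq {m n : Type*} [Fintype n] (N : Matrix m n K) :
    ∃ Q : Matrix n n K, N * Q = 0 ∧ Q.rank + N.rank = Fintype.card n := by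
  classical
  obtain ⟨p, hp⟩ := (LinearMap.ker N.mulVecLin).subtype.exists_leftInverse_of_injective
    (Submodule.ker_subtype _)
  let q := (LinearMap.ker N.mulVecLin).subtype ∘ₗ p
  have mulVecLin_q : (LinearMap.toMatrix' q).mulVecLin = q := by
    rw [← Matrix.toLin'_apply', Matrix.toLin'_toMatrix']
  have range_q : LinearMap.range q = LinearMap.ker N.mulVecLin := by
    rw [LinearMap.range_comp_of_range_eq_top _ (LinearMap.range_eq_top.2 _),
      Submodule.range_subtype]
    exact fun x => ⟨x, LinearMap.congr_fun hp x⟩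
  refine ⟨LinearMap.toMatrix' q, Matrix.toLin'.injective ?_, ?_⟩
  · rw [Matrix.toLin'_mul, Matrix.toLin'_toMatrix', map_zero, Matrix.toLin'_apply',
      ← LinearMap.range_le_ker_iff, range_q]
  · rw [Matrix.rank, Matrix.rank, mulVecLin_q, range_q, add_comm,
      LinearMap.finrank_range_add_finrank_ker, Module.finrank_fintype_fun_eq_card]

variable {ι : Type*} [Fintype ι] [DecidableEq ι]

/-- The fixed vectors of `M` provide matrices `Q` and `T` of rank `card ι - rank (M - 1)` with
`M * Q = Q` and `T * M = T`. Hence `M ⊗ M - 1` becomes `T ⊗ (M - 1)` and `(M - 1) ⊗ Q` when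
multiplied by `T ⊗ 1` and `1 ⊗ Q`, and the Frobenius inequality adds up their ranks. -/
theorem two_mul_rank_mul_card_le (M : Matrix ι ι K) :
    2 * (M - 1).rank * Fintype.card ι ≤ (M ⊗ₖ M - 1).rank + 2 * (M - 1).rank ^ 2 := by
  obtain ⟨Q, hQ, rank_Q⟩ := exists_mul_eq_zero_and_rank_add_rank_eq (M - 1)
  obtain ⟨T, hT, rank_T⟩ := exists_mul_eq_zero_and_rank_add_rank_eq (M - 1).transpose
  rw [Matrix.rank_transpose, ← T.rank_transpose] at rank_T
  have hT' : T.transpose * (M - 1) = 0 := by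
    rw [← Matrix.transpose_transpose (M - 1), ← Matrix.transpose_mul, hT, Matrix.transpose_zero]
  have mul_Q : (M ⊗ₖ M - 1) * ((1 : Matrix ι ι K) ⊗ₖ Q) = (M - 1) ⊗ₖ Q := by
    have fixed : M * Q = Q := by rwa [sub_mul, one_mul, sub_eq_zero] at hQ
    rw [sub_mul, one_mul, ← Matrix.mul_kronecker_mul, fixed, mul_one, sub_eq_iff_eq_add,
      ← Matrix.add_kronecker, sub_add_cancel]
  have T_mul : (T.transpose ⊗ₖ (1 : Matrix ι ι K)) * (M ⊗ₖ M - 1) = T.transpose ⊗ₖ (M - 1) := by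
    have fixed : T.transpose * M = T.transpose := by rwa [mul_sub, mul_one, sub_eq_zero] at hT'
    rw [mul_sub, mul_one, ← Matrix.mul_kronecker_mul, fixed, one_mul, sub_eq_iff_eq_add,
      ← Matrix.kronecker_add, sub_add_cancel]
  have frobenius := rank_mul_add_rank_mul_le (T.transpose ⊗ₖ (1 : Matrix ι ι K)) (M ⊗ₖ M - 1)
    ((1 : Matrix ι ι K) ⊗ₖ Q)
  rw [mul_assoc, mul_Q, T_mul, ← Matrix.mul_kronecker_mul, hT', Matrix.zero_kronecker,
    Matrix.rank_zero, rank_kronecker, rank_kronecker] at frobenius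
  nlinarith

theorem rank_permMatrixHom_sub_one_le (σ : Equiv.Perm ι) :
    (Matrix.permMatrixHom σ - 1 : Matrix ι ι K).rank ≤
      hammingDist (σ : ι → ι) (1 : Equiv.Perm ι) := by
  refine Matrix.rank_le_card_of_support_subset _ _ fun i hi => ?_
  rw [Finset.mem_coe, Finset.mem_filter]
  refine ⟨Finset.mem_univ _, fun fixed => hi (funext fun j => ?_)⟩
  have symm_apply_eq : σ.symm i = i := σ.symm_apply_eq.2 fixed.symm
  simp [Matrix.sub_apply, Matrix.one_apply, symm_apply_eq]

end Rank

section LinearSofic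

variable {ι κ K : Type*} [Fintype ι] [DecidableEq ι] [Fintype κ] [DecidableEq κ] [Field K]

/-- The normalized rank length on `GL_ι(K)`: the distance to the identity in the rank metric, for an
arbitrary finite index set. -/
noncomputable def rankLen (M : GL ι K) : ℝ := ((M.1 - 1).rank : ℝ) / Fintype.card ι

theorem rankLen_nonneg (M : GL ι K) : 0 ≤ rankLen M := by
  unfold rankLen
  positivity

theorem sq_rankLen_le (M : GL ι K) : rankLen M ^ 2 ≤ 2 * rankLen M := by
  have le_one : rankLen M ≤ 1 :=
    div_le_one_of_le₀ (mod_cast Matrix.rank_le_card_height _) (by positivity)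
  nlinarith [rankLen_nonneg M]

theorem nontrivial_GL_prod (A : Type*) [Fintype A] [DecidableEq A] [Nonempty A]
    [Nontrivial (GL ι K)] : Nontrivial (GL (ι × A) K) := by
  have blockDiagonal_const_injective :
      Function.Injective ((Matrix.blockDiagonalRingHom ι A K).toMonoidHom.comp
        (Pi.constRingHom A (Matrix ι ι K)).toMonoidHom) :=
    Matrix.blockDiagonal_injective.comp Function.const_injective
  exact (Units.map_injective blockDiagonal_const_injective).nontrivial

theorem nonempty_of_nontrivial_GL [Nontrivial (GL ι K)] : Nonempty ι := by
  by_contra hι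
  rw [not_nonempty_iff] at hι
  exact not_subsingleton (GL ι K) inferInstance

section Representations

variable [Nonempty ι]

/-- The induced representation of a wreath product of `GL_ι(K)`. -/
noncomputable def linearWreathRep (A : Type*) [Fintype A] [DecidableEq A] [Nonempty A] :
    WreathRep (rankLen : GL ι K → ℝ) A (rankLen : GL (ι × A) K → ℝ) :=
  let hom : PermWreath A (GL ι K) →* GL (ι × A) K := (inducedHom (Units.coeHom _)).toHomUnits
  have len_inl (f : A → GL ι K) : rankLen (hom (.inl f)) = 𝔼 a, rankLen (f a) := by
    have sub_one_eq : (hom (.inl f)).1 - 1 = Matrix.blockDiagonal fun a => (f a).1 - 1 := by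
      rw [← Matrix.blockDiagonal_one, MonoidHom.coe_toHomUnits, inducedHom_inl,
        ← Matrix.blockDiagonal_sub]
      rfl
    rw [rankLen, sub_one_eq, rank_blockDiagonal, Fintype.expect_eq_sum_div_card, Fintype.card_prod]
    simp only [rankLen, ← Finset.sum_div]
    push_cast
    rw [div_div]
  have len_inr_le (σ : Equiv.Perm A) : rankLen (hom (.inr σ)) ≤ hammingMetric σ 1 := by
    have sub_one_eq : (hom (.inr σ)).1 - 1 = 1 ⊗ₖ (Matrix.permMatrixHom σ - 1) := by
      rw [← one_kronecker_sub_one, MonoidHom.coe_toHomUnits, inducedHom_inr]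
    rw [rankLen, sub_one_eq, rank_kronecker, Matrix.rank_one, Fintype.card_prod, Nat.cast_mul,
      Nat.cast_mul, mul_div_mul_left _ _ (by positivity), hammingMetric]
    gcongr
    exact rank_permMatrixHom_sub_one_le σ
  { hom := hom
    expect_le := fun f => (len_inl f).ge
    sq_inl_le := fun f => (sq_rankLen_le _).trans_eq (congrArg (2 * ·) (len_inl f))
    sq_inr_le := fun σ => (sq_rankLen_le _).trans (by linarith [len_inr_le σ]) }

/-- The tensor product of the standard representations of two linear groups. -/
noncomputable def linearProductRep [Nonempty κ] :
    ProductRep (rankLen : GL ι K → ℝ) (rankLen : GL κ K → ℝ) (rankLen : GL (ι × κ) K → ℝ) where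
  hom := (Units.map kroneckerHom).comp MulEquiv.prodUnits.symm.toMonoidHom
  length_left M := by
    change (((M.1 ⊗ₖ (1 : Matrix κ κ K) - 1).rank : ℕ) : ℝ) / _ = _
    rw [kronecker_one_sub_one, rank_kronecker, Matrix.rank_one, Fintype.card_prod, Nat.cast_mul,
      Nat.cast_mul, mul_div_mul_right _ _ (by positivity), rankLen]
  length_right N := by
    change ((((1 : Matrix ι ι K) ⊗ₖ N.1 - 1).rank : ℕ) : ℝ) / _ = _
    rw [one_kronecker_sub_one, rank_kronecker, Matrix.rank_one, Fintype.card_prod, Nat.cast_mul,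
      Nat.cast_mul, mul_div_mul_left _ _ (by positivity), rankLen]

theorem two_mul_rankLen_le_linearProductRep (M : GL ι K) :
    2 * rankLen M ≤ rankLen ((linearProductRep (κ := ι)).hom (M, M)) + 2 * rankLen M ^ 2 := by
  have rank_le : 2 * ((M.1 - 1).rank : ℝ) * Fintype.card ι ≤
      (M.1 ⊗ₖ M.1 - 1).rank + 2 * ((M.1 - 1).rank : ℝ) ^ 2 :=
    mod_cast two_mul_rank_mul_card_le M.1
  change 2 * rankLen M ≤ ((M.1 ⊗ₖ M.1 - 1).rank : ℝ) / Fintype.card (ι × ι) + 2 * rankLen M ^ 2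
  rw [rankLen, Fintype.card_prod, Nat.cast_mul]
  have card_pos : (0 : ℝ) < Fintype.card ι := by positivity
  field_simp
  linarith

end Representations

theorem linearSoficFamily_represents (ι : Type) [Fintype ι] [DecidableEq ι] [Nontrivial (GL ι K)] :
    (linearSoficFamily K).Represents (rankLen : GL ι K → ℝ) := by
  let e : GL ι K ≃* GL (Fin (Fintype.card ι)) K :=
    Units.mapEquiv (Matrix.reindexAlgEquiv K K (Fintype.equivFin ι)).toMulEquiv
  refine ⟨⟨Fintype.card ι, e.symm.toEquiv.nontrivial⟩, e.toMonoidHom, fun M => ?_⟩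
  change ((Matrix.reindexAlgEquiv K K (Fintype.equivFin ι) M.1 - 1).rank : ℝ) / _ = _
  rw [← map_one (Matrix.reindexAlgEquiv K K (Fintype.equivFin ι)), ← map_sub,
    Matrix.coe_reindexAlgEquiv, Matrix.rank_reindex]
  rfl

theorem linearSoficFamily_len {n : ℕ} (hn : Nontrivial (GL (Fin n) K)) :
    (linearSoficFamily K).len ⟨n, hn⟩ = (rankLen : GL (Fin n) K → ℝ) := by
  funext M
  change (_ : ℝ) / (n : ℝ) = _ / (Fintype.card (Fin n) : ℝ)
  rw [Fintype.card_fin]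
  rfl

variable (K) in
theorem linearSoficFamily_isWreathClosed : (linearSoficFamily K).IsWreathClosed where
  exists_wreathRep := by
    rintro ⟨n, hn⟩ A _ _ _
    have := nonempty_of_nontrivial_GL (ι := Fin n) (K := K)
    have := nontrivial_GL_prod (ι := Fin n) (K := K) A
    obtain ⟨k, e, he⟩ := linearSoficFamily_represents (K := K) (Fin n × A)
    rw [linearSoficFamily_len]
    exact ⟨k, ⟨(linearWreathRep A).mapIsometry e he⟩⟩
  exists_productRep := by
    rintro ⟨n, hn⟩ ⟨n', hn'⟩
    have := nonempty_of_nontrivial_GL (ι := Fin n) (K := K)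
    have := nonempty_of_nontrivial_GL (ι := Fin n') (K := K)
    have := nontrivial_GL_prod (ι := Fin n) (K := K) (Fin n')
    obtain ⟨k, e, he⟩ := linearSoficFamily_represents (K := K) (Fin n × Fin n')
    rw [linearSoficFamily_len, linearSoficFamily_len]
    exact ⟨k, ⟨linearProductRep.mapIsometry e he⟩⟩
  exists_expanding_productRep := by
    rintro ⟨n, hn⟩
    have := nonempty_of_nontrivial_GL (ι := Fin n) (K := K)
    have := nontrivial_GL_prod (ι := Fin n) (K := K) (Fin n)
    obtain ⟨k, e, he⟩ := linearSoficFamily_represents (K := K) (Fin n × Fin n)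
    rw [linearSoficFamily_len]
    refine ⟨k, linearProductRep.mapIsometry e he, fun (M : GL (Fin n) K) hM => ?_⟩
    refine le_trans ?_ (he (linearProductRep.hom (M, M))).ge
    have := two_mul_rankLen_le_linearProductRep M
    have := rankLen_nonneg M
    nlinarith

end LinearSofic

section NormalizedTrace

variable {ι κ A : Type*} [Fintype ι] [Fintype κ] [Fintype A] [DecidableEq A]

/-- The trace of a complex matrix, normalized so that the identity has trace one. -/
noncomputable def normalizedTrace (M : Matrix ι ι ℂ) : ℂ := 𝔼 i, M i i

theorem normalizedTrace_one [DecidableEq ι] [Nonempty ι] :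
    normalizedTrace (1 : Matrix ι ι ℂ) = 1 := by
  simp [normalizedTrace]

theorem normalizedTrace_kronecker (M : Matrix ι ι ℂ) (N : Matrix κ κ ℂ) :
    normalizedTrace (M ⊗ₖ N) = normalizedTrace M * normalizedTrace N := by
  rw [normalizedTrace, normalizedTrace, normalizedTrace, Finset.expect_mul_expect,
    ← Finset.univ_product_univ, Finset.expect_product]
  rfl

theorem normalizedTrace_blockDiagonal (M : A → Matrix ι ι ℂ) :
    normalizedTrace (Matrix.blockDiagonal M) = 𝔼 a, normalizedTrace (M a) := by
  simp only [normalizedTrace]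
  rw [← Finset.univ_product_univ, Finset.expect_product, Finset.expect_comm]
  simp only [Matrix.blockDiagonal_apply_eq]

theorem normalizedTrace_permMatrixHom [Nonempty A] (σ : Equiv.Perm A) :
    normalizedTrace (Matrix.permMatrixHom σ) = ((1 - hammingMetric σ 1 : ℝ) : ℂ) := by
  rw [hammingMetric_one_eq_one_sub, sub_sub_cancel, Complex.ofReal_expect, normalizedTrace]
  refine Finset.expect_congr rfl fun a _ => ?_
  have symm_apply_eq_iff : σ.symm a = a ↔ σ a = a := by rw [Equiv.symm_apply_eq, eq_comm]
  simp [symm_apply_eq_iff, apply_ite]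

theorem norm_normalizedTrace_le_one [DecidableEq ι] [Nonempty ι] {U : Matrix ι ι ℂ}
    (hU : U ∈ Matrix.unitaryGroup ι ℂ) : ‖normalizedTrace U‖ ≤ 1 :=
  (RCLike.norm_expect_le (K := ℂ)).trans
    (Finset.expect_le Finset.univ_nonempty fun i _ => entry_norm_bound_of_unitary hU i i)

end NormalizedTrace

section Hyperlinear

variable {ι κ A : Type*} [Fintype ι] [DecidableEq ι] [Fintype κ] [DecidableEq κ] [Fintype A]
  [DecidableEq A]

theorem blockDiagonal_mem_unitaryGroup {f : A → Matrix ι ι ℂ}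
    (hf : ∀ a, f a ∈ Matrix.unitaryGroup ι ℂ) :
    Matrix.blockDiagonal f ∈ Matrix.unitaryGroup (ι × A) ℂ := by
  rw [Matrix.mem_unitaryGroup_iff, Matrix.star_eq_conjTranspose,
    Matrix.blockDiagonal_conjTranspose, ← Matrix.blockDiagonal_mul, ← Matrix.blockDiagonal_one]
  exact congrArg _ (funext fun a => Matrix.mem_unitaryGroup_iff.1 (hf a))

theorem permMatrixHom_mem_unitaryGroup (σ : Equiv.Perm A) :
    Matrix.permMatrixHom σ ∈ Matrix.unitaryGroup A ℂ := by
  have star_eq : star (Matrix.permMatrixHom σ : Matrix A A ℂ) = Matrix.permMatrixHom σ⁻¹ :=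
    Matrix.conjTranspose_permMatrix _
  rw [Matrix.mem_unitaryGroup_iff, star_eq, ← map_mul, mul_inv_cancel, map_one]

theorem inducedHom_subtype_mem_unitaryGroup (x : PermWreath A (Matrix.unitaryGroup ι ℂ)) :
    inducedHom (Matrix.unitaryGroup ι ℂ).subtype x ∈ Matrix.unitaryGroup (ι × A) ℂ :=
  mul_mem (blockDiagonal_mem_unitaryGroup fun a => (x.left a).2)
    (Matrix.kronecker_mem_unitary (one_mem _) (permMatrixHom_mem_unitaryGroup x.right))

/-- The representation of a permutational wreath product of `U(ι)` by unitary monomial block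
matrices. -/
def unitaryInducedHom :
    PermWreath A (Matrix.unitaryGroup ι ℂ) →* Matrix.unitaryGroup (ι × A) ℂ where
  toFun x := ⟨inducedHom (Matrix.unitaryGroup ι ℂ).subtype x,
    inducedHom_subtype_mem_unitaryGroup x⟩
  map_one' := Subtype.ext (map_one _)
  map_mul' x y := Subtype.ext (map_mul _ x y)

theorem normalizedTrace_unitaryInducedHom_inl (f : A → Matrix.unitaryGroup ι ℂ) :
    normalizedTrace (unitaryInducedHom (.inl f)).1 = 𝔼 a, normalizedTrace (f a).1 := by
  refine (congrArg normalizedTrace (inducedHom_inl _ f)).trans ?_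
  exact normalizedTrace_blockDiagonal _

theorem normalizedTrace_unitaryInducedHom_inr [Nonempty ι] [Nonempty A] (σ : Equiv.Perm A) :
    normalizedTrace (unitaryInducedHom (ι := ι) (.inr σ)).1 =
      ((1 - hammingMetric σ 1 : ℝ) : ℂ) := by
  refine (congrArg normalizedTrace (inducedHom_inr _ σ)).trans ?_
  rw [normalizedTrace_kronecker, normalizedTrace_one, one_mul, normalizedTrace_permMatrixHom]

theorem nontrivial_unitaryGroup [Nonempty ι] : Nontrivial (Matrix.unitaryGroup ι ℂ) := by
  refine ⟨1, ⟨-1, by simp [Matrix.mem_unitaryGroup_iff]⟩, fun one_eq_neg_one => ?_⟩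
  have := congrArg normalizedTrace (congrArg Subtype.val one_eq_neg_one)
  norm_num [normalizedTrace] at this

theorem nonempty_of_nontrivial_unitaryGroup [Nontrivial (Matrix.unitaryGroup ι ℂ)] :
    Nonempty ι := by
  by_contra hι
  rw [not_nonempty_iff] at hι
  exact not_subsingleton (Matrix.unitaryGroup ι ℂ) inferInstance

/-- The normalized Hilbert-Schmidt length on `U(ι)`: the distance to the identity in the
Hilbert-Schmidt metric, for an arbitrary finite index set. -/
noncomputable def hsLen (U : Matrix.unitaryGroup ι ℂ) : ℝ :=
  √((1 / Fintype.card ι : ℝ) * ∑ i, ∑ j, ‖U.1 i j - (1 : Matrix ι ι ℂ) i j‖ ^ 2)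

theorem hsLen_nonneg (U : Matrix.unitaryGroup ι ℂ) : 0 ≤ hsLen U := Real.sqrt_nonneg _

section Representations

variable [Nonempty ι] [Nonempty κ] [Nonempty A]

theorem sq_hsLen (U : Matrix.unitaryGroup ι ℂ) :
    hsLen U ^ 2 = 2 - 2 * (normalizedTrace U.1).re := by
  have row_unit (i : ι) : ∑ j, ‖U.1 i j‖ ^ 2 = 1 := by
    have := congrFun (congrFun (Matrix.mem_unitaryGroup_iff.1 U.2) i) i
    rw [Matrix.mul_apply, Matrix.one_apply_eq] at this
    simp only [Matrix.star_apply, RCLike.star_def, Complex.mul_conj'] at this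
    exact_mod_cast this
  have row (i : ι) : ∑ j, ‖U.1 i j - (1 : Matrix ι ι ℂ) i j‖ ^ 2 = 2 - 2 * (U.1 i i).re := by
    simp only [← Complex.normSq_eq_norm_sq, Complex.normSq_sub, Finset.sum_sub_distrib,
      Finset.sum_add_distrib] at row_unit ⊢
    rw [row_unit]
    simp [Matrix.one_apply, apply_ite]
    norm_num
  rw [hsLen, Real.sq_sqrt (by positivity), one_div_mul_eq_div, ← Fintype.expect_eq_sum_div_card]
  simp only [row, Finset.expect_sub_distrib, Fintype.expect_const, ← Finset.mul_expect,
    normalizedTrace, Complex.re_expect]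

theorem hsLen_eq_of_re_normalizedTrace_eq {U : Matrix.unitaryGroup ι ℂ}
    {V : Matrix.unitaryGroup κ ℂ} (h : (normalizedTrace U.1).re = (normalizedTrace V.1).re) :
    hsLen U = hsLen V := by
  rw [← sq_eq_sq₀ (hsLen_nonneg U) (hsLen_nonneg V), sq_hsLen, sq_hsLen, h]

theorem hsLen_le_two (U : Matrix.unitaryGroup ι ℂ) : hsLen U ≤ 2 := by
  refine (sq_le_sq₀ (hsLen_nonneg U) zero_le_two).1 ?_
  have := (abs_le.1 ((Complex.abs_re_le_norm _).trans (norm_normalizedTrace_le_one U.2))).1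
  rw [sq_hsLen]
  linarith

theorem sq_hsLen_unitaryInducedHom_inl (f : A → Matrix.unitaryGroup ι ℂ) :
    hsLen (unitaryInducedHom (.inl f)) ^ 2 = 𝔼 a, hsLen (f a) ^ 2 := by
  simp only [sq_hsLen, normalizedTrace_unitaryInducedHom_inl, Complex.re_expect,
    Finset.expect_sub_distrib, Fintype.expect_const, Finset.mul_expect]

variable (A) in
/-- The induced representation of a wreath product of `U(ι)`. -/
noncomputable def unitaryWreathRep :
    WreathRep (hsLen : Matrix.unitaryGroup ι ℂ → ℝ) A
      (hsLen : Matrix.unitaryGroup (ι × A) ℂ → ℝ) where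
  hom := unitaryInducedHom
  expect_le f := by
    refine (sq_le_sq₀ (Finset.expect_nonneg fun a _ => hsLen_nonneg _) (hsLen_nonneg _)).1 ?_
    rw [sq_hsLen_unitaryInducedHom_inl, Fintype.expect_eq_sum_div_card,
      Fintype.expect_eq_sum_div_card]
    exact sum_div_card_sq_le_sum_sq_div_card
  sq_inl_le f := by
    rw [sq_hsLen_unitaryInducedHom_inl, Finset.mul_expect]
    exact Finset.expect_le_expect fun a _ => by nlinarith [hsLen_nonneg (f a), hsLen_le_two (f a)]
  sq_inr_le σ := by
    rw [sq_hsLen, normalizedTrace_unitaryInducedHom_inr, Complex.ofReal_re]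
    linarith

/-- The tensor product of the standard representations of two unitary groups. -/
noncomputable def unitaryProductRep :
    ProductRep (hsLen : Matrix.unitaryGroup ι ℂ → ℝ) (hsLen : Matrix.unitaryGroup κ ℂ → ℝ)
      (hsLen : Matrix.unitaryGroup (ι × κ) ℂ → ℝ) where
  hom := (kroneckerHom.comp ((Matrix.unitaryGroup ι ℂ).subtype.prodMap
    (Matrix.unitaryGroup κ ℂ).subtype)).codRestrict _
      fun x => Matrix.kronecker_mem_unitary x.1.2 x.2.2
  length_left U := hsLen_eq_of_re_normalizedTrace_eq <| congrArg Complex.re <|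
    (normalizedTrace_kronecker _ _).trans (by simp [normalizedTrace_one])
  length_right V := hsLen_eq_of_re_normalizedTrace_eq <| congrArg Complex.re <|
    (normalizedTrace_kronecker _ _).trans (by simp [normalizedTrace_one])

theorem five_div_four_mul_hsLen_le {U : Matrix.unitaryGroup ι ℂ} (hU : hsLen U ≤ 1 / 6) :
    5 / 4 * hsLen U ≤ hsLen ((unitaryProductRep (κ := ι)).hom (U, U)) := by
  have U_nonneg := hsLen_nonneg U
  have trace_tensor :
      normalizedTrace ((unitaryProductRep (κ := ι)).hom (U, U)).1 = normalizedTrace U.1 ^ 2 :=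
    (normalizedTrace_kronecker _ _).trans (sq _).symm
  have normSq_trace_le : Complex.normSq (normalizedTrace U.1) ≤ 1 := by
    rw [Complex.normSq_eq_norm_sq]
    exact pow_le_one₀ (norm_nonneg _) (norm_normalizedTrace_le_one U.2)
  have sq_len_le : hsLen U ^ 2 ≤ 1 / 36 := by nlinarith
  refine (sq_le_sq₀ (by positivity) (hsLen_nonneg _)).1 ?_
  rw [mul_pow, sq_hsLen, sq_hsLen, trace_tensor, sq (normalizedTrace U.1), Complex.mul_re]
  rw [sq_hsLen] at sq_len_le
  rw [Complex.normSq_apply] at normSq_trace_le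
  nlinarith [sq_nonneg (normalizedTrace U.1).im, sq_nonneg ((normalizedTrace U.1).re - 1)]

end Representations

theorem hyperlinearFamily_represents (ι : Type) [Fintype ι] [DecidableEq ι] [Nonempty ι] :
    hyperlinearFamily.Represents (hsLen : Matrix.unitaryGroup ι ℂ → ℝ) := by
  let r := Matrix.reindexAlgEquiv ℂ ℂ (Fintype.equivFin ι)
  have r_mem (U : Matrix.unitaryGroup ι ℂ) :
      r U.1 ∈ Matrix.unitaryGroup (Fin (Fintype.card ι)) ℂ := by
    have star_eq : star (r U.1) = r (star U.1) := rfl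
    rw [Matrix.mem_unitaryGroup_iff, star_eq, ← map_mul, Matrix.mem_unitaryGroup_iff.1 U.2,
      map_one]
  let e : Matrix.unitaryGroup ι ℂ →* Matrix.unitaryGroup (Fin (Fintype.card ι)) ℂ :=
    (r.toMonoidHom.comp (Matrix.unitaryGroup ι ℂ).subtype).codRestrict _ r_mem
  refine ⟨⟨Fintype.card ι, nontrivial_unitaryGroup⟩, e, fun U => ?_⟩
  change √((1 / Fintype.card ι : ℝ) *
    ∑ i, ∑ j, ‖r U.1 i j - (1 : Matrix (Fin (Fintype.card ι)) (Fin (Fintype.card ι)) ℂ) i j‖ ^ 2) =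
      _
  rw [← (Fintype.equivFin ι).sum_comp]
  simp only [← (Fintype.equivFin ι).sum_comp]
  simp [r, hsLen, Matrix.one_apply]

theorem hyperlinearFamily_len {n : ℕ} (hn : Nontrivial (Matrix.unitaryGroup (Fin n) ℂ)) :
    hyperlinearFamily.len ⟨n, hn⟩ = (hsLen : Matrix.unitaryGroup (Fin n) ℂ → ℝ) := by
  funext U
  change _ = √((1 / Fintype.card (Fin n) : ℝ) * _)
  rw [Fintype.card_fin]
  rfl

theorem hyperlinearFamily_isWreathClosed : hyperlinearFamily.IsWreathClosed where
  exists_wreathRep := by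
    rintro ⟨n, hn⟩ A _ _ _
    have := nonempty_of_nontrivial_unitaryGroup (ι := Fin n)
    obtain ⟨k, e, he⟩ := hyperlinearFamily_represents (Fin n × A)
    rw [hyperlinearFamily_len]
    exact ⟨k, ⟨(unitaryWreathRep A).mapIsometry e he⟩⟩
  exists_productRep := by
    rintro ⟨n, hn⟩ ⟨n', hn'⟩
    have := nonempty_of_nontrivial_unitaryGroup (ι := Fin n)
    have := nonempty_of_nontrivial_unitaryGroup (ι := Fin n')
    obtain ⟨k, e, he⟩ := hyperlinearFamily_represents (Fin n × Fin n')
    rw [hyperlinearFamily_len, hyperlinearFamily_len]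
    exact ⟨k, ⟨unitaryProductRep.mapIsometry e he⟩⟩
  exists_expanding_productRep := by
    rintro ⟨n, hn⟩
    have := nonempty_of_nontrivial_unitaryGroup (ι := Fin n)
    obtain ⟨k, e, he⟩ := hyperlinearFamily_represents (Fin n × Fin n)
    rw [hyperlinearFamily_len]
    refine ⟨k, unitaryProductRep.mapIsometry e he,
      fun (U : Matrix.unitaryGroup (Fin n) ℂ) hU => ?_⟩
    exact (five_div_four_mul_hsLen_le hU).trans_eq (he (unitaryProductRep.hom (U, U))).symm

end Hyperlinear

end MetricApprox

theorem mainTheorem2 (Γ : Type u) [Group Γ] (Δ : Type v) [Group Δ]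
    (β : Γ →* MulAut Δ) :
    (MetricApprox.IsSofic Γ → MetricApprox.IsSofic Δ →
      MetricApprox.IsSoficAction (fun (Λ : Type w) [Group Λ] => MetricApprox.IsSofic Λ) β →
      MetricApprox.IsSofic (Δ ⋊[β] Γ)) ∧
    (∀ (K : Type x) [Field K],
      MetricApprox.IsLinearSofic K Γ → MetricApprox.IsLinearSofic K Δ →
      MetricApprox.IsSoficAction
        (fun (Λ : Type w) [Group Λ] => MetricApprox.IsLinearSofic K Λ) β →
      MetricApprox.IsLinearSofic K (Δ ⋊[β] Γ)) ∧
    (MetricApprox.IsHyperlinear Γ → MetricApprox.IsHyperlinear Δ →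
      MetricApprox.IsSoficAction (fun (Λ : Type w) [Group Λ] => MetricApprox.IsHyperlinear Λ) β →
      MetricApprox.IsHyperlinear (Δ ⋊[β] Γ)) ∧
    (MetricApprox.IsWeaklySofic Γ → MetricApprox.IsWeaklySofic Δ →
      MetricApprox.IsSoficAction (fun (Λ : Type w) [Group Λ] => MetricApprox.IsWeaklySofic Λ) β →
      MetricApprox.IsWeaklySofic (Δ ⋊[β] Γ)) := by
  refine ⟨fun hΓ _ hβ => ?_, fun K _ hΓ _ hβ => ?_, fun hΓ _ hβ => ?_, fun hΓ _ hβ => ?_⟩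
  · exact hΓ.semidirectProduct MetricApprox.soficFamily_isWreathClosed hβ
  · exact hΓ.semidirectProduct (MetricApprox.linearSoficFamily_isWreathClosed K) hβ
  · exact hΓ.semidirectProduct MetricApprox.hyperlinearFamily_isWreathClosed hβ
  · exact hΓ.semidirectProduct MetricApprox.weaklySoficFamily_isWreathClosed hβ
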